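/- Let $H_3$ be the Heisenberg group, that is $\mathbb R^3$ with product $(a,b,c)(x,y,z)=(a+x,\,b+y,\,c+z+\tfrac12(ay-bx))$, so that $\exp(xe_1+ye_2+ze_3)=(x,y,z)$ and $[e_1,e_2]=e_3$, with the left-invariant Riemannian metric for which $e_1,e_2,e_3$ are orthonormal. For $\rho\in\mathbb R$ let $F_{e_1,\rho}$ be the left-invariant Lorentz force with $F e_1=\rho e_2+e_3$, $Fe_2=-\rho e_1$, $Fe_3=-e_1$. A magnetic trajectory of $F$ is a curve with $\nabla_{\gamma'}\gamma'=F\gamma'$. Let $\rho,x_0,y_0,z_0\in\mathbb R$, $c=z_0+\rho$, $h(x)=\frac{x^2}{2}+cx+y_0+1$, and consider $$x''+h'(x)\,h(x)=\rho,\qquad x(0)=0,\quad x'(0)=x_0.\qquad(*)$$ **Magnetic trajectories.** On every open interval $I\ni 0$, a curve $\gamma=\exp(xe_1+ye_2+ze_3)$ is a magnetic trajectory of $F_{e_1,\rho}$ with $\gamma(0)=e$ and $\gamma'(0)=x_0e_1+y_0e_2+z_0e_3$ if and only if $x$ solves $(*)$ on $I$ and, for $t\in I$, $$y(t)=\int_0^t\Big(\tfrac{x(s)^2}{2}+c\,x(s)+y_0\Big)ds,\qquad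 z(t)=-\tfrac12x(t)y(t)-c\,y(t)-x'(t)+x_0.$$ **(i)** If $x_0=0$ and $(y_0+1)(z_0+\rho)=\rho$, the solution of $(*)$ is $x\equiv0$. **(ii)** Suppose $x_0\ge0$ and $x_0^2+(\rho-(y_0+1)(z_0+\rho))^2\ne0$. Put $p_0=2(y_0+1)-c^2$, $q_0=p_0^2+8\rho c-4(x_0^2+(y_0+1)^2)$, $$P(\eta)=x_0^2+(y_0+1)^2-\Big(\tfrac{\eta^2}{2}+y_0+1-\tfrac{c^2}{2}\Big)^2+2\rho(\eta-c)=-\tfrac14(\eta^4+2p_0\eta^2-8\rho\eta+q_0),$$ $$\Delta=q_0p_0^4-8\rho^2p_0^3-432\rho^4+72\rho^2q_0p_0-2q_0^2p_0^2+q_0^3$$ ($\Delta$ is $16$ times the discriminant of $P$). Write $\mathrm{sn}(\cdot,k),\mathrm{cn}(\cdot,k)$ for the Jacobi elliptic functions of modulus $k$, $K(k)=\int_0^{\pi/2}(1-k^2\sin^2\theta)^{-1/2}d\theta$, and let $\mathrm{cn}^{-1}$ and $\mathrm{sn}^{-1}$ take values in $[0,2K(k)]$ and $[-K(k),K(k)]$.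 "Period" means least positive period. In each of the following cases, which are exhaustive, the solution of $(*)$ (defined on $\mathbb R$, and with every solution on an open interval containing $0$ as a restriction) is the function given. 1. $\Delta<0$. The roots of $P$ are two real numbers $r_1<r_4$ and two non-real numbers $r_2,\overline{r_2}$. With $\delta_1=|r_1-r_2|$, $\delta_4=|r_4-r_2|$ and $k=\sqrt{\frac{(r_4-r_1)^2-(\delta_4-\delta_1)^2}{4\delta_4\delta_1}}$ one has $0<k<1$ and $$x(t)=\frac{(r_1\delta_4-r_4\delta_1)\,\mathrm{cn}(u,k)+r_1\delta_4+r_4\delta_1}{(\delta_4-\delta_1)\,\mathrm{cn}(u,k)+\delta_1+\delta_4}-c,\qquad u=\tfrac{\sqrt{\delta_1\delta_4}}{2}t+C_1,$$ $C_1=\mathrm{cn}^{-1}\Big(\frac{(r_4-c)\delta_1-(c-r_1)\delta_4}{(r_4-c)\delta_1+(c-r_1)\delta_4},k\Big)$; the period is $\frac{8K(k)}{\sqrt{\delta_1\delta_4}}$ and the image is $[r_1-c,r_4-c]$. 2. $\Delta>0$. $P$ has four real roots $r_1<r_2<r_3<r_4$, and $r_1\le c\le r_2$ or $r_3\le c\le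 r_4$. Put $k_1=\sqrt{\frac{(r_4-r_3)(r_2-r_1)}{(r_4-r_2)(r_3-r_1)}}$ (then $0<k_1<1$) and $\omega=\frac14\sqrt{(r_4-r_2)(r_3-r_1)}$. The period is $2K(k_1)/\omega$. - If $r_1\le c\le r_2$, then $x(t)=r_4-\dfrac{r_4-r_1}{1+\frac{r_2-r_1}{r_4-r_2}\mathrm{sn}^2(\omega t+C_2,k_1)}-c$ with $C_2=\mathrm{sn}^{-1}\Big(\sqrt{\frac{(r_4-r_2)(c-r_1)}{(r_2-r_1)(r_4-c)}},k_1\Big)$; the image is $[r_1-c,r_2-c]$. - If $r_3\le c\le r_4$, then $x(t)=r_1+\dfrac{r_4-r_1}{1+\frac{r_4-r_3}{r_3-r_1}\mathrm{sn}^2(\omega t-C_3,k_1)}-c$ with $C_3=\mathrm{sn}^{-1}\Big(\sqrt{\frac{(r_3-r_1)(r_4-c)}{(r_4-r_3)(c-r_1)}},k_1\Big)$; the image is $[r_3-c,r_4-c]$. 3. $\Delta=0$ and $p_0^2+3q_0\ne0$. Put $r=\frac{2\rho(p_0^2+3q_0)}{p_0^3-p_0q_0+36\rho^2}$ and $\mu=6\,\frac{9\rho^2-p_0q_0}{p_0^2+3q_0}+\frac{p_0}{2}$.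 Then $r$ is a root of $P$ of multiplicity exactly $2$, $\mu=\frac{p_0+3r^2}{2}\neq0$ and $c\ne r$. Let $s=\sqrt{r^2-\mu}$ and $d=\sqrt{-2(p_0+r^2)}$. - If $\mu>0$, then $x(t)=\dfrac{-2\mu}{r+s\cos(\sqrt\mu\,t-C_4)}+r-c$ with $C_4=\arccos\big(\frac1s(-\frac{2\mu}{c-r}-r)\big)$; the period is $2\pi/\sqrt\mu$ and the image is $[-r-d-c,\,-r+d-c]$. - If $\mu<0$ and $c>r$, then $x(t)=\dfrac{-2\mu}{r+s\cosh(\sqrt{-\mu}\,t+C_5)}+r-c$ with $C_5=-\mathrm{arccosh}\big(\frac1s(-\frac{2\mu}{c-r}-r)\big)$; $x$ is not periodic and its image is $(r-c,\,-r+d-c]$. - If $\mu<0$ and $c<r$, then $x(t)=\dfrac{-2\mu}{r-s\cosh(\sqrt{-\mu}\,t+C_6)}+r-c$ with $C_6=\mathrm{arccosh}\big(\frac1s(\frac{2\mu}{c-r}+r)\big)$; $x$ is not periodic and its image is $[-r-d-c,\,r-c)$. 4. $\Delta=0$ and $p_0^2+3q_0=0$. Then $\rho\ne0$, $r=-\sqrt[3]{\rho}$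 is a root of $P$ of multiplicity $3$, and $x(t)=\dfrac{-4r}{1+r^2(t+C_7)^2}+r-c$ with $C_7=\frac1r\sqrt{\frac{3r+c}{r-c}}$; $x$ is not periodic and its image is $(-\sqrt[3]\rho-c,\,3\sqrt[3]\rho-c]$ if $\rho>0$ and $[3\sqrt[3]\rho-c,\,-\sqrt[3]\rho-c)$ if $\rho<0$. -/

import Mathlib

noncomputable section

namespace HeisMagnetic

/-! ### The Heisenberg group and its magnetic trajectories

The group is modelled on `ℝ³`, written `Fin 3 → ℝ`, in exponential coordinates:
`exp (x e₁ + y e₂ + z e₃) = (x, y, z)`. The identity element is `0`. -/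

/-- The product of the Heisenberg group, with Lie bracket `[e₁, e₂] = e₃`. -/
def heisMul (a b : Fin 3 → ℝ) : Fin 3 → ℝ :=
  ![a 0 + b 0, a 1 + b 1, a 2 + b 2 + (a 0 * b 1 - a 1 * b 0) / 2]

/-- The matrix of the differential at the identity of the left translation by `p`; its columns
are the values at `p` of the left-invariant vector fields `e₁, e₂, e₃`. -/
def leftFrame (p : Fin 3 → ℝ) : Matrix (Fin 3) (Fin 3) ℝ :=
  LinearMap.toMatrix' (fderiv ℝ (heisMul p) 0 : (Fin 3 → ℝ) →ₗ[ℝ] (Fin 3 → ℝ))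

/-- The coefficients, in the coordinates of `ℝ³`, of the left-invariant Riemannian metric for
which the left-invariant fields `e₁, e₂, e₃` are orthonormal. -/
def metric (p : Fin 3 → ℝ) : Matrix (Fin 3) (Fin 3) ℝ :=
  (leftFrame p)⁻¹.transpose * (leftFrame p)⁻¹

/-- The `i`-th partial derivative at `p`. -/
def partialDeriv (i : Fin 3) (f : (Fin 3 → ℝ) → ℝ) (p : Fin 3 → ℝ) : ℝ :=
  fderiv ℝ f p (Pi.single i 1)

/-- The Christoffel symbol `Γᵏᵢⱼ` of the Levi-Civita connection of the metric. -/
def christoffel (k i j : Fin 3) (p : Fin 3 → ℝ) : ℝ :=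
  (1 / 2) * ∑ l : Fin 3, (metric p)⁻¹ k l *
    (partialDeriv i (fun q => metric q j l) p + partialDeriv j (fun q => metric q i l) p
      - partialDeriv l (fun q => metric q i j) p)

/-- The matrix, in the basis `e₁, e₂, e₃`, of the skew-symmetric map `F_{U,ρ}` of the Heisenberg
Lie algebra, where `U = β e₁ + α e₂`. -/
def lorentzMatrix (β α ρ : ℝ) : Matrix (Fin 3) (Fin 3) ℝ :=
  !![0, -ρ, -β; ρ, 0, -α; β, α, 0]

/-- The left-invariant `(1,1)`-tensor which is `F` at the identity, in coordinates at `p`. -/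
def leftInvariantTensor (F : Matrix (Fin 3) (Fin 3) ℝ) (p : Fin 3 → ℝ) :
    Matrix (Fin 3) (Fin 3) ℝ :=
  leftFrame p * F * (leftFrame p)⁻¹

/-- The curve `γ` satisfies `∇_{γ'} γ' = F γ'` on the set `I`. -/
def IsMagneticTrajectoryOn (F : Matrix (Fin 3) (Fin 3) ℝ) (I : Set ℝ) (γ : ℝ → Fin 3 → ℝ) :
    Prop :=
  ∀ t ∈ I, DifferentiableAt ℝ γ t ∧ DifferentiableAt ℝ (deriv γ) t ∧
    ∀ k : Fin 3,
      deriv (deriv γ) t k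
          + ∑ i : Fin 3, ∑ j : Fin 3, christoffel k i j (γ t) * deriv γ t i * deriv γ t j
        = (leftInvariantTensor F (γ t)).mulVec (deriv γ t) k

/-! ### The second order equation -/

/-- `h(x) = x²/2 + (z₀+ρ) x + y₀ + 1`. -/
def hFun (ρ y₀ z₀ x : ℝ) : ℝ := x ^ 2 / 2 + (z₀ + ρ) * x + y₀ + 1

/-- `x` solves `x'' + h'(x) h(x) = ρ`, `x(0) = 0`, `x'(0) = x₀` on the set `I`. -/
def IsSolutionOn (ρ x₀ y₀ z₀ : ℝ) (I : Set ℝ) (x : ℝ → ℝ) : Prop :=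
  x 0 = 0 ∧ deriv x 0 = x₀ ∧
    ∀ t ∈ I, DifferentiableAt ℝ x t ∧ DifferentiableAt ℝ (deriv x) t ∧
      deriv (deriv x) t + deriv (hFun ρ y₀ z₀) (x t) * hFun ρ y₀ z₀ (x t) = ρ

/-- An open interval that contains `0`. -/
def IsOpenIntervalAtZero (I : Set ℝ) : Prop := IsOpen I ∧ I.OrdConnected ∧ (0 : ℝ) ∈ I

/-- `X` is the solution of the initial value problem: it solves it on the whole line, and every
solution on an open interval around `0` is a restriction of `X`. -/
def IsTheSolution (ρ x₀ y₀ z₀ : ℝ) (X : ℝ → ℝ) : Prop :=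
  IsSolutionOn ρ x₀ y₀ z₀ Set.univ X ∧
    ∀ I : Set ℝ, IsOpenIntervalAtZero I → ∀ x : ℝ → ℝ, IsSolutionOn ρ x₀ y₀ z₀ I x →
      Set.EqOn x X I

/-- `T` is the (least positive) period of `X`. -/
def HasPeriod (X : ℝ → ℝ) (T : ℝ) : Prop :=
  0 < T ∧ Function.Periodic X T ∧ ∀ T' : ℝ, 0 < T' → Function.Periodic X T' → T ≤ T'

/-- `X` is not periodic. -/
def NotPeriodic (X : ℝ → ℝ) : Prop := ∀ T : ℝ, T ≠ 0 → ¬ Function.Periodic X T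

/-! ### Jacobi elliptic functions of real argument and modulus `0 ≤ k < 1` -/

/-- The incomplete elliptic integral of the first kind. -/
def ellipticF (φ k : ℝ) : ℝ := ∫ θ in (0 : ℝ)..φ, 1 / √(1 - k ^ 2 * Real.sin θ ^ 2)

/-- The complete elliptic integral of the first kind. -/
def ellipticK (k : ℝ) : ℝ := ellipticF (Real.pi / 2) k

/-- The Jacobi amplitude: for `0 ≤ k < 1`, the inverse of the increasing bijection
`φ ↦ F(φ, k)` of `ℝ`. -/
def jacobiAm (u k : ℝ) : ℝ := Function.invFun (fun φ : ℝ => ellipticF φ k) u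

def jacobiSn (u k : ℝ) : ℝ := Real.sin (jacobiAm u k)

def jacobiCn (u k : ℝ) : ℝ := Real.cos (jacobiAm u k)

/-- For `0 ≤ k < 1`, the inverse of `sn(·, k) : [-K(k), K(k)] → [-1, 1]`. -/
def jacobiArcsn (s k : ℝ) : ℝ := ellipticF (Real.arcsin s) k

/-- For `0 ≤ k < 1`, the inverse of `cn(·, k) : [0, 2K(k)] → [-1, 1]`. -/
def jacobiArccn (c k : ℝ) : ℝ := ellipticF (Real.arccos c) k

/-! ### The quartic and its invariants -/

/-- `P(η) = x₀² + (y₀+1)² - (η²/2 + y₀ + 1 - (z₀+ρ)²/2)² + 2ρ (η - z₀ - ρ)`. -/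
def quartic (ρ x₀ y₀ z₀ : ℝ) : Polynomial ℝ :=
  Polynomial.C (x₀ ^ 2 + (y₀ + 1) ^ 2)
    - (Polynomial.C (1 / 2) * Polynomial.X ^ 2
        + Polynomial.C (y₀ + 1 - (z₀ + ρ) ^ 2 / 2)) ^ 2
    + Polynomial.C (2 * ρ) * (Polynomial.X - Polynomial.C (z₀ + ρ))

def pZero (ρ y₀ z₀ : ℝ) : ℝ := 2 * (y₀ + 1) - (z₀ + ρ) ^ 2

def qZero (ρ x₀ y₀ z₀ : ℝ) : ℝ :=
  pZero ρ y₀ z₀ ^ 2 + 8 * ρ * (z₀ + ρ) - 4 * (x₀ ^ 2 + (y₀ + 1) ^ 2)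

/-- The discriminant `Δ`, as a function of `ρ, p₀, q₀`. -/
def discPoly (ρ p q : ℝ) : ℝ :=
  q * p ^ 4 - 8 * ρ ^ 2 * p ^ 3 - 432 * ρ ^ 4 + 72 * ρ ^ 2 * q * p - 2 * q ^ 2 * p ^ 2 + q ^ 3

/-- `μ`, as a function of `ρ, p₀, q₀`. -/
def muPar (ρ p q : ℝ) : ℝ := 6 * ((9 * ρ ^ 2 - p * q) / (p ^ 2 + 3 * q)) + p / 2

/-- The double root `r`, as a function of `ρ, p₀, q₀`. -/
def rPar (ρ p q : ℝ) : ℝ := 2 * ρ * (p ^ 2 + 3 * q) / (p ^ 3 - p * q + 36 * ρ ^ 2)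

/-- The real cube root. -/
def cubeRoot (a : ℝ) : ℝ := Real.sign a * |a| ^ ((1 : ℝ) / 3)

/-! ### The explicit solutions; `c` stands for `z₀ + ρ` -/

/-- The modulus for one pair of non-real roots, where `d₁ = |r₁ - r₂|`, `d₄ = |r₄ - r₂|`. -/
def modulusCn (r₁ r₄ d₁ d₄ : ℝ) : ℝ :=
  √(((r₄ - r₁) ^ 2 - (d₄ - d₁) ^ 2) / (4 * d₄ * d₁))

def solCn (c r₁ r₄ d₁ d₄ t : ℝ) : ℝ :=
  let k := modulusCn r₁ r₄ d₁ d₄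
  let C₁ := jacobiArccn
    (((r₄ - c) * d₁ - (c - r₁) * d₄) / ((r₄ - c) * d₁ + (c - r₁) * d₄)) k
  let u := jacobiCn (√(d₁ * d₄) / 2 * t + C₁) k
  ((r₁ * d₄ - r₄ * d₁) * u + r₁ * d₄ + r₄ * d₁) / ((d₄ - d₁) * u + d₁ + d₄) - c

/-- The modulus `k₁` for four real roots. -/
def modulusSn (r₁ r₂ r₃ r₄ : ℝ) : ℝ :=
  √((r₄ - r₃) * (r₂ - r₁) / ((r₄ - r₂) * (r₃ - r₁)))

def solSnLow (c r₁ r₂ r₃ r₄ t : ℝ) : ℝ :=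
  let k₁ := modulusSn r₁ r₂ r₃ r₄
  let C₂ := jacobiArcsn (√((r₄ - r₂) * (c - r₁) / ((r₂ - r₁) * (r₄ - c)))) k₁
  let u := jacobiSn (√((r₄ - r₂) * (r₃ - r₁)) / 4 * t + C₂) k₁
  r₄ - (r₄ - r₁) / (1 + (r₂ - r₁) / (r₄ - r₂) * u ^ 2) - c

def solSnHigh (c r₁ r₂ r₃ r₄ t : ℝ) : ℝ :=
  let k₁ := modulusSn r₁ r₂ r₃ r₄
  let C₃ := jacobiArcsn (√((r₃ - r₁) * (r₄ - c) / ((r₄ - r₃) * (c - r₁)))) k₁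
  let u := jacobiSn (√((r₄ - r₂) * (r₃ - r₁)) / 4 * t - C₃) k₁
  r₁ + (r₄ - r₁) / (1 + (r₄ - r₃) / (r₃ - r₁) * u ^ 2) - c

def solCos (c r μ t : ℝ) : ℝ :=
  let C₄ := Real.arccos (1 / √(r ^ 2 - μ) * (-(2 * μ) / (c - r) - r))
  (-(2 * μ)) / (r + √(r ^ 2 - μ) * Real.cos (√μ * t - C₄)) + r - c

def solCoshRight (c r μ t : ℝ) : ℝ :=
  let C₅ := -Real.arcosh (1 / √(r ^ 2 - μ) * (-(2 * μ) / (c - r) - r))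
  (-(2 * μ)) / (r + √(r ^ 2 - μ) * Real.cosh (√(-μ) * t + C₅)) + r - c

def solCoshLeft (c r μ t : ℝ) : ℝ :=
  let C₆ := Real.arcosh (1 / √(r ^ 2 - μ) * (2 * μ / (c - r) + r))
  (-(2 * μ)) / (r - √(r ^ 2 - μ) * Real.cosh (√(-μ) * t + C₆)) + r - c

def solRational (c r t : ℝ) : ℝ :=
  let C₇ := 1 / r * √((3 * r + c) / (r - c))
  (-(4 * r)) / (1 + r ^ 2 * (t + C₇) ^ 2) + r - c

end HeisMagnetic

end

open HeisMagnetic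

/-!
The shifted coordinate `η = x + c`, with `c = z₀ + ρ`, satisfies `η'' = P'(η) / 2`, hence
`η' ^ 2 = P(η)` along the solution with the given initial data, where `P` is the energy quartic.
Everything about the solutions follows from this one-dimensional motion.

*Trajectories.* In exponential coordinates the Christoffel symbols are polynomials, and the equation
`∇_{γ'} γ' = F γ'` has the first integrals `w - x = z₀` (with `w` the `e₃`-component of the
velocity) and `y' - x² / 2 - c x = y₀`; what remains is the second order equation for `x`
(`IsMagneticTrajectoryOn.isSolutionOn`, `IsSolutionOn.isMagneticTrajectoryOn`).

*Uniqueness* is the Picard–Lindelöf theorem for the associated first order system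
(`IsSolutionOn.eqOn`).

*Solutions.* Each explicit solution is `η = g ∘ w` with `g` a Möbius transformation and `w` one of
`cn`, `sn²`, `cos`, `cosh` or a quadratic polynomial in time. These `w` satisfy `w' ^ 2 = A(w)` and
`w'' = A'(w) / 2` for a polynomial `A`, and `g` is chosen so that `g' ^ 2 A = P ∘ g`. Differentiating
this identity shows that `g ∘ w` solves the equation, turning points included, and the sign of `w'`
at time zero gives `x'(0) = x₀ ≥ 0` (`isTheSolution_moebius`).

*Periods and images.* In the periodic cases the solution is an injective function of `cos ψ`, where
`ψ` is an increasing bijection of the line which gains `2π` in one period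
(`period_range_moebius_cos`). In the other cases it is an injective function of a `w` with image
`[1, ∞)` that takes the value `1` only once (`notPeriodic_range_of_unbounded`).

*Roots.* Outside the degenerate case `P` is positive somewhere, so it has two real roots `a < b`.
Dividing them out leaves a quadratic factor with discriminant `D`, and the discriminant of `P` is a
square times `D`, up to a positive constant (`discPoly_eq`): its sign decides between the cases.
-/

namespace HeisMagnetic

open Set

/-! ### The initial value problem -/

lemma deriv_hFun (ρ y₀ z₀ x : ℝ) : deriv (hFun ρ y₀ z₀) x = x + (z₀ + ρ) := by
  have h : HasDerivAt (hFun ρ y₀ z₀) (2 * x / 2 + (z₀ + ρ) * 1) x := by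
    have := ((((hasDerivAt_id x).pow 2).div_const 2).add
      ((hasDerivAt_id x).const_mul (z₀ + ρ))).add_const (y₀ + 1)
    refine (this.congr_of_eventuallyEq ?_).congr_deriv ?_
    · filter_upwards with y
      simp [hFun]
      ring
    · simp
  rw [h.deriv]
  ring

/-- The first order system `x' = v`, `v' = ρ - h'(x) h(x)` equivalent to the equation. -/
noncomputable def phaseField (ρ y₀ z₀ : ℝ) (w : ℝ × ℝ) : ℝ × ℝ :=
  (w.2, ρ - (w.1 + (z₀ + ρ)) * hFun ρ y₀ z₀ w.1)

lemma contDiff_phaseField (ρ y₀ z₀ : ℝ) : ContDiff ℝ 1 (phaseField ρ y₀ z₀) := by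
  unfold phaseField hFun
  fun_prop

lemma IsSolutionOn.hasDerivAt_phase {ρ x₀ y₀ z₀ : ℝ} {I : Set ℝ} {x : ℝ → ℝ}
    (hx : IsSolutionOn ρ x₀ y₀ z₀ I x) {t : ℝ} (ht : t ∈ I) :
    HasDerivAt (fun s => (x s, deriv x s)) (phaseField ρ y₀ z₀ (x t, deriv x t)) t := by
  obtain ⟨h1, h2, h3⟩ := hx.2.2 t ht
  rw [deriv_hFun] at h3
  have h2' := h2.hasDerivAt
  rw [eq_sub_of_add_eq h3] at h2'
  exact h1.hasDerivAt.prodMk h2'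

/-- Two solutions on an open interval around `0` agree there: the field of the first order system
is Lipschitz on the compact sets in which the two phase curves stay. -/
lemma IsSolutionOn.eqOn {ρ x₀ y₀ z₀ : ℝ} {I : Set ℝ} (hI : IsOpenIntervalAtZero I) {x X : ℝ → ℝ}
    (hx : IsSolutionOn ρ x₀ y₀ z₀ I x) (hX : IsSolutionOn ρ x₀ y₀ z₀ I X) : EqOn x X I := by
  obtain ⟨hIo, hIc, h0⟩ := hI
  intro t ht
  obtain ⟨a, ha, haI⟩ : ∃ a < min 0 t, a ∈ I := by
    have hm : min 0 t ∈ I := by rcases min_choice 0 t with h | h <;> rw [h] <;> assumption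
    obtain ⟨ε, hε, hb⟩ := Metric.isOpen_iff.1 hIo _ hm
    refine ⟨min 0 t - ε / 2, by linarith, hb ?_⟩
    rw [Metric.mem_ball, Real.dist_eq, abs_lt]
    constructor <;> linarith
  obtain ⟨b, hb, hbI⟩ : ∃ b > max 0 t, b ∈ I := by
    have hm : max 0 t ∈ I := by rcases max_choice 0 t with h | h <;> rw [h] <;> assumption
    obtain ⟨ε, hε, hb⟩ := Metric.isOpen_iff.1 hIo _ hm
    refine ⟨max 0 t + ε / 2, by linarith, hb ?_⟩
    rw [Metric.mem_ball, Real.dist_eq, abs_lt]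
    constructor <;> linarith
  have hsub : Icc a b ⊆ I := hIc.out haI hbI
  have ha' := lt_min_iff.1 ha
  have hb' := max_lt_iff.1 hb
  have hcx : ContinuousOn (fun s => (x s, deriv x s)) (Icc a b) := fun s hs =>
    (hx.hasDerivAt_phase (hsub hs)).continuousAt.continuousWithinAt
  have hcX : ContinuousOn (fun s => (X s, deriv X s)) (Icc a b) := fun s hs =>
    (hX.hasDerivAt_phase (hsub hs)).continuousAt.continuousWithinAt
  have hK := (isCompact_Icc.image_of_continuousOn hcx).union
    (isCompact_Icc.image_of_continuousOn hcX)
  obtain ⟨K, hL⟩ := LocallyLipschitzOn.exists_lipschitzOnWith_of_compact hK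
    ((contDiff_phaseField ρ y₀ z₀).locallyLipschitz.locallyLipschitzOn)
  have key := ODE_solution_unique_of_mem_Icc (v := fun _ => phaseField ρ y₀ z₀)
    (fun _ _ => hL) (t₀ := 0) ⟨ha'.1, hb'.1⟩ hcx
    (fun s hs => hx.hasDerivAt_phase (hsub (Ioo_subset_Icc_self hs)))
    (fun s hs => Or.inl ⟨s, Ioo_subset_Icc_self hs, rfl⟩) hcX
    (fun s hs => hX.hasDerivAt_phase (hsub (Ioo_subset_Icc_self hs)))
    (fun s hs => Or.inr ⟨s, Ioo_subset_Icc_self hs, rfl⟩)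
    (by simp only [hx.1, hX.1, hx.2.1, hX.2.1])
  exact congrArg Prod.fst (key ⟨ha'.2.le, hb'.2.le⟩)

/-- A global solution of the first order system is *the* solution. -/
lemma isTheSolution_of_hasDerivAt {ρ x₀ y₀ z₀ : ℝ} {X V : ℝ → ℝ}
    (hX : ∀ t, HasDerivAt X (V t) t)
    (hV : ∀ t, HasDerivAt V (ρ - (X t + (z₀ + ρ)) * hFun ρ y₀ z₀ (X t)) t)
    (hX0 : X 0 = 0) (hV0 : V 0 = x₀) : IsTheSolution ρ x₀ y₀ z₀ X := by
  have hd : deriv X = V := funext fun t => (hX t).deriv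
  have hsol : ∀ I, IsSolutionOn ρ x₀ y₀ z₀ I X := fun I => by
    refine ⟨hX0, by rw [hd, hV0], fun t _ => ⟨(hX t).differentiableAt, ?_, ?_⟩⟩
    · rw [hd]
      exact (hV t).differentiableAt
    · rw [hd, (hV t).deriv, deriv_hFun]
      ring
  exact ⟨hsol _, fun I hI x hx => hx.eqOn hI (hsol I)⟩

/-- The degenerate case: the origin is an equilibrium. -/
lemma isTheSolution_zero {ρ x₀ y₀ z₀ : ℝ} (hx₀ : x₀ = 0) (h : (y₀ + 1) * (z₀ + ρ) = ρ) :
    IsTheSolution ρ x₀ y₀ z₀ (fun _ => 0) := by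
  refine isTheSolution_of_hasDerivAt (V := fun _ => 0) (fun t => hasDerivAt_const _ _)
    (fun t => ?_) rfl hx₀.symm
  have : ρ - (0 + (z₀ + ρ)) * hFun ρ y₀ z₀ 0 = 0 := by
    simp only [hFun]
    linear_combination -h
  simpa only [this] using hasDerivAt_const t (0 : ℝ)

/-! ### The energy quartic -/

lemma quartic_eval (ρ x₀ y₀ z₀ η : ℝ) : (quartic ρ x₀ y₀ z₀).eval η =
    -(η ^ 4 + 2 * pZero ρ y₀ z₀ * η ^ 2 - 8 * ρ * η + qZero ρ x₀ y₀ z₀) / 4 := by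
  simp [quartic, qZero, pZero]
  ring

lemma quartic_eval_initial (ρ x₀ y₀ z₀ : ℝ) :
    (quartic ρ x₀ y₀ z₀).eval (z₀ + ρ) = x₀ ^ 2 := by
  rw [quartic_eval, qZero, pZero]
  ring

lemma hasDerivAt_quartic (ρ x₀ y₀ z₀ η : ℝ) :
    HasDerivAt (fun η => (quartic ρ x₀ y₀ z₀).eval η)
      (2 * (ρ - η * hFun ρ y₀ z₀ (η - (z₀ + ρ)))) η := by
  simp only [quartic_eval]
  have h := (((((hasDerivAt_id η).pow 4).add
    (((hasDerivAt_id η).pow 2).const_mul (2 * pZero ρ y₀ z₀))).sub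
    ((hasDerivAt_id η).const_mul (8 * ρ))).add_const (qZero ρ x₀ y₀ z₀)).neg.div_const 4
  refine h.congr_deriv ?_
  simp [hFun, pZero]
  ring

/-- If `w'' = A'(w) / 2` with energy relation `w' ^ 2 = A(w)` and `g` carries `g' ^ 2 A` to `P ∘ g`,
then `η = g ∘ w` satisfies `η'' = P'(η) / 2`. Differentiating the identity between `g`, `A` and `P`
and dividing by `g'` gives the second derivative even where `w'` vanishes. -/
lemma hasDerivAt_comp_of_energy {w v A A₁ g g₁ g₂ P P₁ : ℝ → ℝ} {S : Set ℝ} (hS : IsOpen S)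
    (hA : ∀ y, HasDerivAt A (A₁ y) y) (hg : ∀ y ∈ S, HasDerivAt g (g₁ y) y)
    (hg₁ : ∀ y ∈ S, HasDerivAt g₁ (g₂ y) y) (hP : ∀ y, HasDerivAt P (P₁ y) y)
    (hid : ∀ y ∈ S, g₁ y ^ 2 * A y = P (g y)) (hne : ∀ y ∈ S, g₁ y ≠ 0)
    (hw : ∀ t, HasDerivAt w (v t) t) (hv : ∀ t, HasDerivAt v (A₁ (w t) / 2) t)
    (hE : ∀ t, v t ^ 2 = A (w t)) (hmem : ∀ t, w t ∈ S) (t : ℝ) :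
    HasDerivAt (fun t => g₁ (w t) * v t) (P₁ (g (w t)) / 2) t := by
  have hy := hmem t
  have h1 := ((hg₁ _ hy).pow 2).mul (hA (w t))
  have h2 := (hP (g (w t))).comp (w t) (hg _ hy)
  have h3 := h1.unique (h2.congr_of_eventuallyEq
    (Filter.eventuallyEq_of_mem (hS.mem_nhds hy) fun y hy => hid y hy))
  refine (((hg₁ _ hy).comp t (hw t)).mul (hv t)).congr_deriv ?_
  have := hE t
  refine mul_left_cancel₀ (hne _ hy) ?_
  simp only [Function.comp, Pi.pow_apply] at h3 ⊢
  push_cast at h3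
  linear_combination (g₁ (w t) * g₂ (w t)) * this + h3 / 2

/-- A Möbius transform `(a w + b) / (m w + n)` of a solution of a one-dimensional energy equation
`w' ^ 2 = A(w)`, with `A` matched to the quartic, is the solution shifted by `c = z₀ + ρ`. -/
lemma isTheSolution_moebius {ρ x₀ y₀ z₀ : ℝ} (hx₀ : 0 ≤ x₀) {w v A A₁ : ℝ → ℝ} (a b m n : ℝ)
    (hA : ∀ y, HasDerivAt A (A₁ y) y)
    (hw : ∀ t, HasDerivAt w (v t) t) (hv : ∀ t, HasDerivAt v (A₁ (w t) / 2) t)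
    (hE : ∀ t, v t ^ 2 = A (w t)) (hmem : ∀ t, m * w t + n ≠ 0) (hdet : a * n - b * m ≠ 0)
    (hid : ∀ y, m * y + n ≠ 0 → (a * n - b * m) ^ 2 * A y
      = (quartic ρ x₀ y₀ z₀).eval ((a * y + b) / (m * y + n)) * (m * y + n) ^ 4)
    (h0 : (a * w 0 + b) / (m * w 0 + n) = z₀ + ρ) (hsgn : 0 ≤ (a * n - b * m) * v 0) :
    IsTheSolution ρ x₀ y₀ z₀ (fun t => (a * w t + b) / (m * w t + n) - (z₀ + ρ)) := by
  set D := a * n - b * m with hD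
  have hlin : ∀ a b y : ℝ, HasDerivAt (fun y => a * y + b) a y := fun a b y => by
    simpa using ((hasDerivAt_id y).const_mul a).add_const b
  have hg : ∀ y ∈ {y : ℝ | m * y + n ≠ 0}, HasDerivAt (fun y => (a * y + b) / (m * y + n))
      (D / (m * y + n) ^ 2) y := fun y hy => by
    refine ((hlin a b y).div (hlin m n y) hy).congr_deriv ?_
    rw [hD]
    ring
  have hg₁ : ∀ y ∈ {y : ℝ | m * y + n ≠ 0}, HasDerivAt (fun y => D / (m * y + n) ^ 2)
      (-(2 * D * m) / (m * y + n) ^ 3) y := fun y hy => by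
    have hy' : m * y + n ≠ 0 := hy
    refine ((hasDerivAt_const y D).div ((hlin m n y).pow 2) (pow_ne_zero 2 hy)).congr_deriv ?_
    simp only [Pi.pow_apply]
    field_simp
    push_cast
    ring
  have hS : IsOpen {y : ℝ | m * y + n ≠ 0} := isOpen_ne_fun (by fun_prop) (by fun_prop)
  have hid' : ∀ y ∈ {y : ℝ | m * y + n ≠ 0}, (D / (m * y + n) ^ 2) ^ 2 * A y
      = (quartic ρ x₀ y₀ z₀).eval ((a * y + b) / (m * y + n)) := fun y hy => by
    have hy' : m * y + n ≠ 0 := hy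
    rw [div_pow, ← pow_mul, div_mul_eq_mul_div, hid y hy, mul_div_cancel_right₀]
    exact pow_ne_zero 4 hy'
  refine isTheSolution_of_hasDerivAt (V := fun t => D / (m * w t + n) ^ 2 * v t)
    (fun t => ((hg _ (hmem t)).comp t (hw t)).sub_const _) (fun t => ?_) ?_ ?_
  · refine (hasDerivAt_comp_of_energy hS hA hg hg₁ (hasDerivAt_quartic ρ x₀ y₀ z₀) hid'
      (fun y hy => div_ne_zero hdet (pow_ne_zero 2 hy)) hw hv hE hmem t).congr_deriv ?_
    ring
  · simp only [h0, sub_self]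
  · -- both sides are nonnegative with the same square, the value of the quartic at `c`
    have h1 := hid' _ (hmem 0)
    rw [h0, quartic_eval_initial, ← hE 0, ← mul_pow] at h1
    refine (pow_left_inj₀ ?_ hx₀ two_ne_zero).1 h1
    rw [div_mul_eq_mul_div]
    positivity

/-! ### Jacobi elliptic functions -/

section

open Filter Topology

/-- The Jacobi delta amplitude `dn(u, k)`, i.e. the derivative of the amplitude. -/
noncomputable def jacobiDn (u k : ℝ) : ℝ := √(1 - k ^ 2 * jacobiSn u k ^ 2)

section Elliptic

variable {k : ℝ}

lemma one_sub_sq_mul_sin_sq_pos (hk : k ^ 2 < 1) (θ : ℝ) : 0 < 1 - k ^ 2 * Real.sin θ ^ 2 := by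
  nlinarith [Real.sin_sq_le_one θ, sq_nonneg (Real.sin θ), sq_nonneg k]

lemma continuous_ellipticF_integrand (hk : k ^ 2 < 1) :
    Continuous fun θ : ℝ => 1 / √(1 - k ^ 2 * Real.sin θ ^ 2) :=
  Continuous.div continuous_const (by fun_prop) fun θ =>
    (Real.sqrt_pos.2 (one_sub_sq_mul_sin_sq_pos hk θ)).ne'

lemma hasDerivAt_ellipticF (hk : k ^ 2 < 1) (φ : ℝ) :
    HasDerivAt (fun φ => ellipticF φ k) (1 / √(1 - k ^ 2 * Real.sin φ ^ 2)) φ :=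
  ((continuous_ellipticF_integrand hk).integral_hasStrictDerivAt 0 φ).hasDerivAt

lemma strictMono_ellipticF (hk : k ^ 2 < 1) : StrictMono fun φ => ellipticF φ k :=
  strictMono_of_deriv_pos fun φ => by
    rw [(hasDerivAt_ellipticF hk φ).deriv]
    exact one_div_pos.2 (Real.sqrt_pos.2 (one_sub_sq_mul_sin_sq_pos hk φ))

lemma ellipticF_neg (φ k : ℝ) : ellipticF (-φ) k = -ellipticF φ k := by
  unfold ellipticF
  have := intervalIntegral.integral_comp_neg (a := 0) (b := φ)
    (fun θ => 1 / √(1 - k ^ 2 * Real.sin θ ^ 2))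
  simp only [Real.sin_neg, neg_sq, neg_zero] at this
  rw [this, intervalIntegral.integral_symm]

lemma ellipticF_add_pi (hk : k ^ 2 < 1) (φ : ℝ) :
    ellipticF (φ + Real.pi) k = ellipticF φ k + 2 * ellipticK k := by
  have hc := continuous_ellipticF_integrand hk
  have hint : ∀ a b, IntervalIntegrable (fun θ : ℝ => 1 / √(1 - k ^ 2 * Real.sin θ ^ 2))
      MeasureTheory.volume a b := fun a b => hc.intervalIntegrable a b
  have hper : Function.Periodic (fun θ : ℝ => 1 / √(1 - k ^ 2 * Real.sin θ ^ 2)) Real.pi := by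
    intro θ
    simp only [Real.sin_add_pi, neg_sq]
  have h1 := hper.intervalIntegral_add_eq φ (-(Real.pi / 2))
  have h2 := intervalIntegral.integral_add_adjacent_intervals (hint 0 φ) (hint φ (φ + Real.pi))
  have h3 := intervalIntegral.integral_add_adjacent_intervals (hint (-(Real.pi / 2)) 0)
    (hint 0 (Real.pi / 2))
  have h4 := ellipticF_neg (Real.pi / 2) k
  rw [intervalIntegral.integral_symm] at h3
  rw [show -(Real.pi / 2) + Real.pi = Real.pi / 2 by ring, ← h3] at h1
  rw [h1] at h2
  unfold ellipticK
  unfold ellipticF at *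
  linarith

lemma surjective_ellipticF (hk : k ^ 2 < 1) : Function.Surjective fun φ => ellipticF φ k := by
  have hc : Continuous fun φ => ellipticF φ k :=
    continuous_iff_continuousAt.2 fun φ => (hasDerivAt_ellipticF hk φ).continuousAt
  -- the integrand is at least `1`
  have hle : ∀ φ, 0 ≤ φ → φ ≤ ellipticF φ k := fun φ hφ => by
    have := intervalIntegral.integral_mono_on (μ := MeasureTheory.volume) hφ
      (f := fun _ => (1 : ℝ)) (g := fun θ : ℝ => 1 / √(1 - k ^ 2 * Real.sin θ ^ 2))
      (by simp) ((continuous_ellipticF_integrand hk).intervalIntegrable 0 φ) fun θ _ => by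
        have h := one_sub_sq_mul_sin_sq_pos hk θ
        rw [le_div_iff₀ (Real.sqrt_pos.2 h), one_mul, Real.sqrt_le_one]
        nlinarith [sq_nonneg (k * Real.sin θ)]
    simpa [ellipticF] using this
  refine hc.surjective ?_ ?_
  · exact tendsto_atTop_mono' _ ((eventually_ge_atTop 0).mono hle) tendsto_id
  · refine tendsto_atBot_mono' _ ((eventually_le_atBot 0).mono fun φ hφ => ?_) tendsto_id
    have := hle (-φ) (by linarith)
    rw [ellipticF_neg] at this
    simp only [id]
    linarith

lemma ellipticF_jacobiAm (hk : k ^ 2 < 1) (u : ℝ) : ellipticF (jacobiAm u k) k = u :=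
  Function.rightInverse_invFun (surjective_ellipticF hk) u

lemma jacobiAm_ellipticF (hk : k ^ 2 < 1) (φ : ℝ) : jacobiAm (ellipticF φ k) k = φ :=
  Function.leftInverse_invFun (strictMono_ellipticF hk).injective φ

lemma strictMono_jacobiAm (hk : k ^ 2 < 1) : StrictMono fun u => jacobiAm u k := fun u v h => by
  rw [← (strictMono_ellipticF hk).lt_iff_lt]
  simpa only [ellipticF_jacobiAm hk] using h

lemma surjective_jacobiAm (hk : k ^ 2 < 1) : Function.Surjective fun u => jacobiAm u k :=
  fun φ => ⟨_, jacobiAm_ellipticF hk φ⟩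

lemma jacobiAm_add_two_mul_ellipticK (hk : k ^ 2 < 1) (u : ℝ) :
    jacobiAm (u + 2 * ellipticK k) k = jacobiAm u k + Real.pi := by
  rw [← (strictMono_ellipticF hk).injective.eq_iff]
  simp only [ellipticF_jacobiAm hk, ellipticF_add_pi hk]

lemma hasDerivAt_jacobiAm (hk : k ^ 2 < 1) (u : ℝ) :
    HasDerivAt (fun u => jacobiAm u k) (jacobiDn u k) u := by
  have hcont : Continuous fun u => jacobiAm u k :=
    (strictMono_jacobiAm hk).monotone.continuous_of_surjective (surjective_jacobiAm hk)
  have h := one_sub_sq_mul_sin_sq_pos hk (jacobiAm u k)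
  have := HasDerivAt.of_local_left_inverse hcont.continuousAt
    (hasDerivAt_ellipticF hk (jacobiAm u k)) (one_div_pos.2 (Real.sqrt_pos.2 h)).ne'
    (Eventually.of_forall fun v => ellipticF_jacobiAm hk v)
  simpa [jacobiDn, jacobiSn] using this

lemma jacobiDn_sq (hk : k ^ 2 < 1) (u : ℝ) : jacobiDn u k ^ 2 = 1 - k ^ 2 * jacobiSn u k ^ 2 :=
  Real.sq_sqrt (one_sub_sq_mul_sin_sq_pos hk _).le

lemma jacobiDn_pos (hk : k ^ 2 < 1) (u : ℝ) : 0 < jacobiDn u k :=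
  Real.sqrt_pos.2 (one_sub_sq_mul_sin_sq_pos hk _)

lemma jacobiSn_sq (u k : ℝ) : jacobiSn u k ^ 2 = 1 - jacobiCn u k ^ 2 :=
  Real.sin_sq _

lemma hasDerivAt_jacobiSn (hk : k ^ 2 < 1) (u : ℝ) :
    HasDerivAt (fun u => jacobiSn u k) (jacobiCn u k * jacobiDn u k) u :=
  (hasDerivAt_jacobiAm hk u).sin

lemma hasDerivAt_jacobiCn (hk : k ^ 2 < 1) (u : ℝ) :
    HasDerivAt (fun u => jacobiCn u k) (-jacobiSn u k * jacobiDn u k) u :=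
  (hasDerivAt_jacobiAm hk u).cos

lemma hasDerivAt_jacobiDn (hk : k ^ 2 < 1) (u : ℝ) :
    HasDerivAt (fun u => jacobiDn u k) (-(k ^ 2 * jacobiSn u k * jacobiCn u k)) u := by
  have h := (((hasDerivAt_jacobiSn hk u).pow 2).const_mul (k ^ 2)).const_sub 1
  refine (h.sqrt (one_sub_sq_mul_sin_sq_pos hk _).ne').congr_deriv ?_
  have h0 := (jacobiDn_pos hk u).ne'
  change _ / (2 * jacobiDn u k) = _
  field_simp
  push_cast
  ring

lemma jacobiCn_jacobiArccn (hk : k ^ 2 < 1) {s : ℝ} (h₁ : -1 ≤ s) (h₂ : s ≤ 1) :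
    jacobiCn (jacobiArccn s k) k = s := by
  rw [jacobiCn, jacobiArccn, jacobiAm_ellipticF hk, Real.cos_arccos h₁ h₂]

lemma jacobiSn_jacobiArccn_nonneg (hk : k ^ 2 < 1) (s : ℝ) :
    0 ≤ jacobiSn (jacobiArccn s k) k := by
  rw [jacobiSn, jacobiArccn, jacobiAm_ellipticF hk]
  exact Real.sin_nonneg_of_nonneg_of_le_pi (Real.arccos_nonneg s) (Real.arccos_le_pi s)

lemma jacobiSn_jacobiArcsn (hk : k ^ 2 < 1) {s : ℝ} (h₁ : -1 ≤ s) (h₂ : s ≤ 1) :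
    jacobiSn (jacobiArcsn s k) k = s := by
  rw [jacobiSn, jacobiArcsn, jacobiAm_ellipticF hk, Real.sin_arcsin h₁ h₂]

lemma jacobiCn_jacobiArcsn_nonneg (hk : k ^ 2 < 1) (s : ℝ) :
    0 ≤ jacobiCn (jacobiArcsn s k) k := by
  rw [jacobiCn, jacobiArcsn, jacobiAm_ellipticF hk]
  exact Real.cos_arcsin_nonneg s

lemma jacobiAm_neg (hk : k ^ 2 < 1) (u : ℝ) : jacobiAm (-u) k = -jacobiAm u k := by
  rw [← (strictMono_ellipticF hk).injective.eq_iff]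
  simp only [ellipticF_jacobiAm hk, ellipticF_neg]

lemma jacobiSn_neg (hk : k ^ 2 < 1) (u : ℝ) : jacobiSn (-u) k = -jacobiSn u k := by
  rw [jacobiSn, jacobiAm_neg hk, Real.sin_neg, jacobiSn]

lemma jacobiCn_neg (hk : k ^ 2 < 1) (u : ℝ) : jacobiCn (-u) k = jacobiCn u k := by
  rw [jacobiCn, jacobiAm_neg hk, Real.cos_neg, jacobiCn]

end Elliptic

/-! ### Periods and images -/

/-- A function of `cos ψ`, one-to-one in `cos ψ`, has the period over which `ψ` gains `2π`. -/
lemma hasPeriod_comp_cos {ψ g : ℝ → ℝ} {T : ℝ} (hψ : StrictMono ψ)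
    (hs : Function.Surjective ψ) (hT : ∀ t, ψ (t + T) = ψ t + 2 * Real.pi)
    (hg : InjOn g (Icc (-1) 1)) : HasPeriod (fun t => g (Real.cos (ψ t))) T := by
  refine ⟨?_, fun t => by simp only [hT, Real.cos_add_two_pi], fun T' hT' hp => ?_⟩
  · have h := hT 0
    have : ψ 0 < ψ (0 + T) := by linarith [Real.pi_pos]
    simpa using hψ.lt_iff_lt.1 this
  · obtain ⟨t, ht⟩ := hs 0
    have h1 := hg (Real.cos_mem_Icc _) (Real.cos_mem_Icc _) (hp t)
    rw [ht, Real.cos_zero, Real.cos_eq_one_iff] at h1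
    obtain ⟨n, hn⟩ := h1
    have hpos : ψ t < ψ (t + T') := hψ (by linarith)
    rw [ht, ← hn] at hpos
    have hn1 : (1 : ℝ) ≤ n := by
      have : (0 : ℝ) < n := by
        by_contra! h
        nlinarith [Real.pi_pos]
      exact_mod_cast (by exact_mod_cast this : (0 : ℤ) < n)
    have : ψ (t + T) ≤ ψ (t + T') := by
      rw [hT, ht, ← hn]
      nlinarith [Real.pi_pos]
    have := hψ.le_iff_le.1 this
    linarith

lemma range_comp_cos {ψ : ℝ → ℝ} (hs : Function.Surjective ψ) (g : ℝ → ℝ) :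
    range (fun t => g (Real.cos (ψ t))) = g '' Icc (-1) 1 := by
  rw [← Real.range_cos, ← range_comp]
  exact hs.range_comp fun x => g (Real.cos x)

lemma _root_.StrictAntiOn.image_Icc_eq {g : ℝ → ℝ} {a b : ℝ} (hab : a ≤ b)
    (hg : StrictAntiOn g (Icc a b)) (hc : ContinuousOn g (Icc a b)) :
    g '' Icc a b = Icc (g b) (g a) := by
  refine Subset.antisymm ?_ (intermediate_value_Icc' hab hc)
  rintro _ ⟨x, hx, rfl⟩
  exact ⟨hg.antitoneOn hx (right_mem_Icc.2 hab) hx.2, hg.antitoneOn (left_mem_Icc.2 hab) hx hx.1⟩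

lemma _root_.StrictMonoOn.image_Icc_eq {g : ℝ → ℝ} {a b : ℝ} (hab : a ≤ b)
    (hg : StrictMonoOn g (Icc a b)) (hc : ContinuousOn g (Icc a b)) :
    g '' Icc a b = Icc (g a) (g b) := by
  refine Subset.antisymm ?_ (intermediate_value_Icc hab hc)
  rintro _ ⟨x, hx, rfl⟩
  exact ⟨hg.monotoneOn (left_mem_Icc.2 hab) hx hx.1, hg.monotoneOn hx (right_mem_Icc.2 hab) hx.2⟩

lemma moebius_sub (a b m n x y : ℝ) (hx : m * x + n ≠ 0) (hy : m * y + n ≠ 0) :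
    (a * y + b) / (m * y + n) - (a * x + b) / (m * x + n)
      = (a * n - b * m) * (y - x) / ((m * y + n) * (m * x + n)) := by
  rw [div_sub_div _ _ hy hx]
  ring

/-- A decreasing Möbius function of `cos ψ`: its period and image. -/
lemma period_range_moebius_cos {ψ : ℝ → ℝ} {T : ℝ} (hψ : StrictMono ψ)
    (hs : Function.Surjective ψ) (hT : ∀ t, ψ (t + T) = ψ t + 2 * Real.pi) {a b m n : ℝ} (c : ℝ)
    (hpos : ∀ y ∈ Icc (-1 : ℝ) 1, 0 < m * y + n) (hdet : a * n - b * m < 0) :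
    HasPeriod (fun t => (a * Real.cos (ψ t) + b) / (m * Real.cos (ψ t) + n) - c) T ∧
    range (fun t => (a * Real.cos (ψ t) + b) / (m * Real.cos (ψ t) + n) - c)
      = Icc ((a + b) / (m + n) - c) ((-a + b) / (-m + n) - c) := by
  have hanti : StrictAntiOn (fun y => (a * y + b) / (m * y + n) - c) (Icc (-1) 1) := by
    intro x hx y hy hxy
    have h := moebius_sub a b m n x y (hpos x hx).ne' (hpos y hy).ne'
    have : (a * n - b * m) * (y - x) / ((m * y + n) * (m * x + n)) < 0 :=
      div_neg_of_neg_of_pos (mul_neg_of_neg_of_pos hdet (sub_pos.2 hxy))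
        (mul_pos (hpos y hy) (hpos x hx))
    simp only
    linarith
  refine ⟨hasPeriod_comp_cos hψ hs hT hanti.injOn, ?_⟩
  rw [range_comp_cos hs (fun y => (a * y + b) / (m * y + n) - c),
    hanti.image_Icc_eq (by norm_num)]
  · simp
  · refine ContinuousOn.sub (ContinuousOn.div (by fun_prop) (by fun_prop)
      fun y hy => (hpos y hy).ne') continuousOn_const

/-- An increasing Möbius function of `cos ψ`: its period and image. -/
lemma period_range_moebius_cos' {ψ : ℝ → ℝ} {T : ℝ} (hψ : StrictMono ψ)
    (hs : Function.Surjective ψ) (hT : ∀ t, ψ (t + T) = ψ t + 2 * Real.pi) {a b m n : ℝ} (c : ℝ)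
    (hpos : ∀ y ∈ Icc (-1 : ℝ) 1, 0 < m * y + n) (hdet : 0 < a * n - b * m) :
    HasPeriod (fun t => (a * Real.cos (ψ t) + b) / (m * Real.cos (ψ t) + n) - c) T ∧
    range (fun t => (a * Real.cos (ψ t) + b) / (m * Real.cos (ψ t) + n) - c)
      = Icc ((-a + b) / (-m + n) - c) ((a + b) / (m + n) - c) := by
  have hmono : StrictMonoOn (fun y => (a * y + b) / (m * y + n) - c) (Icc (-1) 1) := by
    intro x hx y hy hxy
    have h := moebius_sub a b m n x y (hpos x hx).ne' (hpos y hy).ne'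
    have : 0 < (a * n - b * m) * (y - x) / ((m * y + n) * (m * x + n)) :=
      div_pos (mul_pos hdet (sub_pos.2 hxy)) (mul_pos (hpos y hy) (hpos x hx))
    simp only
    linarith
  refine ⟨hasPeriod_comp_cos hψ hs hT hmono.injOn, ?_⟩
  rw [range_comp_cos hs (fun y => (a * y + b) / (m * y + n) - c),
    hmono.image_Icc_eq (by norm_num)]
  · simp
  · refine ContinuousOn.sub (ContinuousOn.div (by fun_prop) (by fun_prop)
      fun y hy => (hpos y hy).ne') continuousOn_const

end

/-! ### Magnetic trajectories of the Heisenberg group -/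

section

open Matrix

lemma heisMul_eq (p b : Fin 3 → ℝ) :
    heisMul p b = p + !![1, 0, 0; 0, 1, 0; -p 1 / 2, p 0 / 2, 1] *ᵥ b := by
  ext i
  fin_cases i <;> simp [heisMul, dotProduct, Fin.sum_univ_three]
  ring

lemma leftFrame_eq (p : Fin 3 → ℝ) :
    leftFrame p = !![1, 0, 0; 0, 1, 0; -p 1 / 2, p 0 / 2, 1] := by
  have h : heisMul p = fun b => p + (Matrix.toLin' !![1, 0, 0; 0, 1, 0; -p 1 / 2, p 0 / 2, 1]
      ).toContinuousLinearMap b := funext fun b => by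
    rw [heisMul_eq]
    rfl
  have h' := ((Matrix.toLin' !![1, 0, 0; 0, 1, 0; -p 1 / 2, p 0 / 2, 1]
    ).toContinuousLinearMap.hasFDerivAt (x := 0)).const_add p
  rw [leftFrame, h, h'.fderiv]
  simp

lemma leftFrame_inv (p : Fin 3 → ℝ) :
    (leftFrame p)⁻¹ = !![1, 0, 0; 0, 1, 0; p 1 / 2, -p 0 / 2, 1] := by
  refine Matrix.inv_eq_right_inv ?_
  rw [leftFrame_eq]
  ext i j
  fin_cases i <;> fin_cases j <;> simp [Matrix.mul_apply, Fin.sum_univ_three] <;> ring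

lemma metric_eq (p : Fin 3 → ℝ) : metric p =
    !![1 + p 1 ^ 2 / 4, -(p 0 * p 1) / 4, p 1 / 2;
      -(p 0 * p 1) / 4, 1 + p 0 ^ 2 / 4, -p 0 / 2;
      p 1 / 2, -p 0 / 2, 1] := by
  rw [metric, leftFrame_inv]
  ext i j
  fin_cases i <;> fin_cases j <;>
    simp [Matrix.mul_apply, Fin.sum_univ_three] <;> ring

lemma metric_inv (p : Fin 3 → ℝ) : (metric p)⁻¹ =
    !![1, 0, -p 1 / 2; 0, 1, p 0 / 2; -p 1 / 2, p 0 / 2, 1 + (p 0 ^ 2 + p 1 ^ 2) / 4] := by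
  refine Matrix.inv_eq_right_inv ?_
  rw [metric_eq]
  ext i j
  fin_cases i <;> fin_cases j <;>
    simp [Matrix.mul_apply, Fin.sum_univ_three] <;> ring

/-- Partial derivatives of the quadratic polynomials in the first two coordinates, which are the
coefficients of the metric. -/
lemma partialDeriv_quadratic (a b d e f g : ℝ) (i : Fin 3) (p : Fin 3 → ℝ) :
    partialDeriv i (fun q => a + b * q 0 ^ 2 + d * (q 0 * q 1) + e * q 1 ^ 2 + f * q 0 + g * q 1) p
      = ![2 * b * p 0 + d * p 1 + f, d * p 0 + 2 * e * p 1 + g, 0] i := by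
  have h0 := hasFDerivAt_apply (𝕜 := ℝ) (0 : Fin 3) p
  have h1 := hasFDerivAt_apply (𝕜 := ℝ) (1 : Fin 3) p
  have h := ((((((hasFDerivAt_const a p).add ((h0.pow 2).const_mul b)).add
    ((h0.mul h1).const_mul d)).add ((h1.pow 2).const_mul e)).add (h0.const_mul f)).add
    (h1.const_mul g))
  unfold partialDeriv
  erw [h.fderiv]
  fin_cases i <;> simp <;> ring

lemma partialDeriv_metric (i j l : Fin 3) (p : Fin 3 → ℝ) :
    partialDeriv i (fun q => metric q j l) p =
      ![!![0, -p 1 / 4, 0; -p 1 / 4, p 0 / 2, -(1 / 2); 0, -(1 / 2), 0] j l,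
        !![p 1 / 2, -p 0 / 4, 1 / 2; -p 0 / 4, 0, 0; 1 / 2, 0, 0] j l, 0] i := by
  have h : ∀ a b d e f g : ℝ, (∀ q : Fin 3 → ℝ, metric q j l =
      a + b * q 0 ^ 2 + d * (q 0 * q 1) + e * q 1 ^ 2 + f * q 0 + g * q 1) →
      partialDeriv i (fun q => metric q j l) p =
        ![2 * b * p 0 + d * p 1 + f, d * p 0 + 2 * e * p 1 + g, 0] i := fun a b d e f g h => by
    rw [funext h, partialDeriv_quadratic]
  simp only [metric_eq] at h ⊢
  fin_cases j <;> fin_cases l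
  · rw [h 1 0 0 (1 / 4) 0 0 fun q => by simp; ring]
    fin_cases i <;> simp
    ring
  · rw [h 0 0 (-(1 / 4)) 0 0 0 fun q => by simp; ring]
    fin_cases i <;> simp <;> ring
  · rw [h 0 0 0 0 0 (1 / 2) fun q => by simp; ring]
    fin_cases i <;> simp
  · rw [h 0 0 (-(1 / 4)) 0 0 0 fun q => by simp; ring]
    fin_cases i <;> simp <;> ring
  · rw [h 1 (1 / 4) 0 0 0 0 fun q => by simp; ring]
    fin_cases i <;> simp
    ring
  · rw [h 0 0 0 0 (-(1 / 2)) 0 fun q => by simp; ring]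
    fin_cases i <;> simp
  · rw [h 0 0 0 0 0 (1 / 2) fun q => by simp; ring]
    fin_cases i <;> simp
  · rw [h 0 0 0 0 (-(1 / 2)) 0 fun q => by simp; ring]
    fin_cases i <;> simp
  · rw [h 1 0 0 0 0 0 fun q => by simp]
    fin_cases i <;> simp

/-- The equation `∇_{γ'} γ' = F γ'` at one point, in terms of the position `p`, the coordinate
velocity `v` and the coordinate acceleration `a`. The number `v₂ + (p₁ v₀ - p₀ v₁) / 2` is the
`e₃`-component of the velocity in the left-invariant frame. -/
lemma magnetic_equation_iff (ρ : ℝ) (p v a : Fin 3 → ℝ) :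
    (∀ k : Fin 3, a k + ∑ i : Fin 3, ∑ j : Fin 3, christoffel k i j p * v i * v j
        = (leftInvariantTensor (lorentzMatrix 1 0 ρ) p).mulVec v k) ↔
      a 0 + v 1 * (v 2 + (p 1 * v 0 - p 0 * v 1) / 2)
        = -ρ * v 1 - (v 2 + (p 1 * v 0 - p 0 * v 1) / 2) ∧
      a 1 - v 0 * (v 2 + (p 1 * v 0 - p 0 * v 1) / 2) = ρ * v 0 ∧
      a 2 + (p 1 * a 0 - p 0 * a 1) / 2 = v 0 := by
  have hΓ : ∀ k, ∑ i : Fin 3, ∑ j : Fin 3, christoffel k i j p * v i * v j =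
      ![v 1 * (v 2 + (p 1 * v 0 - p 0 * v 1) / 2),
        -v 0 * (v 2 + (p 1 * v 0 - p 0 * v 1) / 2),
        -(p 1 * v 1 + p 0 * v 0) / 2 * (v 2 + (p 1 * v 0 - p 0 * v 1) / 2)] k := fun k => by
    simp only [christoffel, partialDeriv_metric, metric_inv, Fin.sum_univ_three]
    fin_cases k <;> simp <;> ring
  have hF : ∀ k, (leftInvariantTensor (lorentzMatrix 1 0 ρ) p).mulVec v k =
      ![-ρ * v 1 - (v 2 + (p 1 * v 0 - p 0 * v 1) / 2), ρ * v 0,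
        -p 1 / 2 * (-ρ * v 1 - (v 2 + (p 1 * v 0 - p 0 * v 1) / 2))
          + p 0 / 2 * (ρ * v 0) + v 0] k := fun k => by
    rw [leftInvariantTensor, leftFrame_inv, leftFrame_eq, lorentzMatrix]
    fin_cases k <;>
      simp [Matrix.mul_apply, Matrix.mulVec, dotProduct, Fin.sum_univ_three] <;> ring
  simp only [hΓ, hF]
  constructor
  · intro h
    have h0 := h 0
    have h1 := h 1
    have h2 := h 2
    simp at h0 h1 h2
    refine ⟨by linarith, by linarith, ?_⟩
    linear_combination h2 + p 1 / 2 * h0 - p 0 / 2 * h1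
  · rintro ⟨h0, h1, h2⟩ k
    fin_cases k
    · simpa using h0
    · simp
      linarith
    · simp
      linear_combination h2 - p 1 / 2 * h0 + p 0 / 2 * h1

end

section

open Matrix

lemma IsOpenIntervalAtZero.eq_of_hasDerivAt_zero {I : Set ℝ} (hI : IsOpenIntervalAtZero I)
    {f : ℝ → ℝ} (hf : ∀ t ∈ I, HasDerivAt f 0 t) {t : ℝ} (ht : t ∈ I) : f t = f 0 :=
  hI.1.is_const_of_deriv_eq_zero hI.2.1.isPreconnected
    (fun s hs => (hf s hs).differentiableAt.differentiableWithinAt) (fun s hs => (hf s hs).deriv)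
    ht hI.2.2

lemma IsOpenIntervalAtZero.hasDerivAt_integral {I : Set ℝ} (hI : IsOpenIntervalAtZero I)
    {f : ℝ → ℝ} (hf : ContinuousOn f I) {t : ℝ} (ht : t ∈ I) :
    HasDerivAt (fun t => ∫ s in (0 : ℝ)..t, f s) (f t) t :=
  intervalIntegral.integral_hasDerivAt_right
    ((hf.mono (hI.2.1.uIcc_subset hI.2.2 ht)).intervalIntegrable)
    (hf.stronglyMeasurableAtFilter hI.1 t ht) (hf.continuousAt (hI.1.mem_nhds ht))

/-- The first integrals of the magnetic equation: the `e₃`-component of the velocity is `x + z₀`,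
then `y' = x² / 2 + c x + y₀`, and these two reduce the equation to the one for `x`. -/
lemma IsMagneticTrajectoryOn.isSolutionOn {ρ x₀ y₀ z₀ : ℝ} {I : Set ℝ}
    (hI : IsOpenIntervalAtZero I) {γ : ℝ → Fin 3 → ℝ}
    (h : IsMagneticTrajectoryOn (lorentzMatrix 1 0 ρ) I γ) (h0 : γ 0 = 0)
    (h0' : deriv γ 0 = ![x₀, y₀, z₀]) :
    IsSolutionOn ρ x₀ y₀ z₀ I (fun t => γ t 0) ∧
      ∀ t ∈ I, γ t 1 = ∫ s in (0 : ℝ)..t, ((γ s 0) ^ 2 / 2 + (z₀ + ρ) * γ s 0 + y₀) ∧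
        γ t 2 = -(1 / 2) * γ t 0 * γ t 1 - (z₀ + ρ) * γ t 1
          - deriv (fun s => γ s 0) t + x₀ := by
  have hγ : ∀ t ∈ I, ∀ i, HasDerivAt (fun s => γ s i) (deriv γ t i) t := fun t ht i =>
    hasDerivAt_pi.1 (h t ht).1.hasDerivAt i
  have hγ' : ∀ t ∈ I, ∀ i, HasDerivAt (fun s => deriv γ s i) (deriv (deriv γ) t i) t :=
    fun t ht i => hasDerivAt_pi.1 (h t ht).2.1.hasDerivAt i
  have heq := fun t (ht : t ∈ I) => (magnetic_equation_iff ρ _ _ _).1 (h t ht).2.2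
  have hp : ∀ i, γ 0 i = 0 := fun i => by rw [h0]; rfl
  have hv0 : deriv γ 0 0 = x₀ := by rw [h0']; rfl
  have hv1 : deriv γ 0 1 = y₀ := by rw [h0']; rfl
  have hv2 : deriv γ 0 2 = z₀ := by rw [h0']; rfl
  have hw : ∀ t ∈ I, deriv γ t 2 + (γ t 1 * deriv γ t 0 - γ t 0 * deriv γ t 1) / 2
      = γ t 0 + z₀ := fun t ht => by
    have := hI.eq_of_hasDerivAt_zero (f := fun t => deriv γ t 2
      + (γ t 1 * deriv γ t 0 - γ t 0 * deriv γ t 1) / 2 - γ t 0) (fun t ht => by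
        refine (((hγ' t ht 2).add ((((hγ t ht 1).mul (hγ' t ht 0)).sub
          ((hγ t ht 0).mul (hγ' t ht 1))).div_const 2)).sub (hγ t ht 0)).congr_deriv ?_
        linear_combination (heq t ht).2.2) ht
    simp only [hp, hv2] at this
    linear_combination this
  have hy : ∀ t ∈ I, deriv γ t 1 = γ t 0 ^ 2 / 2 + (z₀ + ρ) * γ t 0 + y₀ := fun t ht => by
    have := hI.eq_of_hasDerivAt_zero (f := fun t => deriv γ t 1
      - (γ t 0 ^ 2 / 2 + (z₀ + ρ) * γ t 0)) (fun t ht => by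
        refine ((hγ' t ht 1).sub ((((hγ t ht 0).pow 2).div_const 2).add
          ((hγ t ht 0).const_mul (z₀ + ρ)))).congr_deriv ?_
        have := (heq t ht).2.1
        rw [hw t ht] at this
        push_cast
        linear_combination this) ht
    simp only [hp, hv1] at this
    linear_combination this
  have hacc : ∀ t ∈ I, deriv (deriv γ) t 0 =
      ρ - (γ t 0 + (z₀ + ρ)) * hFun ρ y₀ z₀ (γ t 0) := fun t ht => by
    have := (heq t ht).1
    rw [hw t ht, hy t ht] at this
    rw [hFun]
    linear_combination this
  have hd : ∀ t ∈ I, deriv (fun s => γ s 0) t = deriv γ t 0 := fun t ht => (hγ t ht 0).deriv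
  have hd' : ∀ t ∈ I, HasDerivAt (deriv fun s => γ s 0) (deriv (deriv γ) t 0) t := fun t ht =>
    (hγ' t ht 0).congr_of_eventuallyEq (Filter.eventuallyEq_of_mem (hI.1.mem_nhds ht) hd)
  refine ⟨⟨hp 0, by rw [hd 0 hI.2.2, hv0], fun t ht => ⟨(hγ t ht 0).differentiableAt,
    (hd' t ht).differentiableAt, ?_⟩⟩, fun t ht => ⟨?_, ?_⟩⟩
  · rw [(hd' t ht).deriv, deriv_hFun, hacc t ht]
    ring
  · have hc : ContinuousOn (fun s => (γ s 0) ^ 2 / 2 + (z₀ + ρ) * γ s 0 + y₀) I := by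
      have : ContinuousOn (fun s => γ s 0) I := fun s hs =>
        (hγ s hs 0).continuousAt.continuousWithinAt
      fun_prop
    have := hI.eq_of_hasDerivAt_zero (f := fun t => γ t 1
      - ∫ s in (0 : ℝ)..t, ((γ s 0) ^ 2 / 2 + (z₀ + ρ) * γ s 0 + y₀)) (fun t ht => by
        refine ((hγ t ht 1).sub (hI.hasDerivAt_integral hc ht)).congr_deriv ?_
        rw [hy t ht, sub_self]) ht
    simp only [hp, intervalIntegral.integral_same] at this
    linear_combination this
  · have := hI.eq_of_hasDerivAt_zero (f := fun t => γ t 2 + (1 / 2) * (γ t 0 * γ t 1)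
      + (z₀ + ρ) * γ t 1 + deriv γ t 0) (fun t ht => by
        refine ((((hγ t ht 2).add (((hγ t ht 0).mul (hγ t ht 1)).const_mul (1 / 2))).add
          ((hγ t ht 1).const_mul (z₀ + ρ))).add (hγ' t ht 0)).congr_deriv ?_
        have h1 := (heq t ht).1
        have h2 := hw t ht
        rw [h2] at h1
        linear_combination h1 + h2) ht
    simp only [hp, hv0] at this
    rw [hd t ht]
    linear_combination this

/-- Conversely, a solution `x`, completed by the two quadratures, is a magnetic trajectory. -/
lemma IsSolutionOn.isMagneticTrajectoryOn {ρ x₀ y₀ z₀ : ℝ} {I : Set ℝ}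
    (hI : IsOpenIntervalAtZero I) {γ : ℝ → Fin 3 → ℝ}
    (h : IsSolutionOn ρ x₀ y₀ z₀ I (fun t => γ t 0))
    (hyz : ∀ t ∈ I, γ t 1 = ∫ s in (0 : ℝ)..t, ((γ s 0) ^ 2 / 2 + (z₀ + ρ) * γ s 0 + y₀) ∧
        γ t 2 = -(1 / 2) * γ t 0 * γ t 1 - (z₀ + ρ) * γ t 1
          - deriv (fun s => γ s 0) t + x₀) :
    IsMagneticTrajectoryOn (lorentzMatrix 1 0 ρ) I γ ∧ γ 0 = 0 ∧ deriv γ 0 = ![x₀, y₀, z₀] := by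
  obtain ⟨hx0, hv0, hx⟩ := h
  simp only at hx0
  set v := deriv (fun s => γ s 0) with hv
  set q : ℝ → ℝ := fun t => (γ t 0) ^ 2 / 2 + (z₀ + ρ) * γ t 0 + y₀ with hq
  set a : ℝ → ℝ := fun t => ρ - (γ t 0 + (z₀ + ρ)) * hFun ρ y₀ z₀ (γ t 0) with ha
  have dx : ∀ t ∈ I, HasDerivAt (fun s => γ s 0) (v t) t := fun t ht => (hx t ht).1.hasDerivAt
  have dv : ∀ t ∈ I, HasDerivAt v (a t) t := fun t ht => by
    refine (hx t ht).2.1.hasDerivAt.congr_deriv ?_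
    have := (hx t ht).2.2
    rw [deriv_hFun] at this
    rw [ha]
    linear_combination this
  have hc : ContinuousOn q I := by
    have : ContinuousOn (fun s => γ s 0) I := fun s hs =>
      (dx s hs).continuousAt.continuousWithinAt
    fun_prop
  have dy : ∀ t ∈ I, HasDerivAt (fun s => γ s 1) (q t) t := fun t ht =>
    (hI.hasDerivAt_integral hc ht).congr_of_eventuallyEq
      (Filter.eventuallyEq_of_mem (hI.1.mem_nhds ht) fun s hs => (hyz s hs).1)
  have dz : ∀ t ∈ I, HasDerivAt (fun s => γ s 2)
      (γ t 0 + z₀ + (γ t 0 * q t - v t * γ t 1) / 2) t := fun t ht => by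
    have h1 := (((((dx t ht).const_mul (-(1 / 2))).mul (dy t ht)).sub
      ((dy t ht).const_mul (z₀ + ρ))).sub (dv t ht)).add_const x₀
    refine (h1.congr_of_eventuallyEq (Filter.eventuallyEq_of_mem (hI.1.mem_nhds ht)
      fun s hs => (hyz s hs).2)).congr_deriv ?_
    simp only [ha, hq, hFun]
    ring
  have dq : ∀ t ∈ I, HasDerivAt q (γ t 0 * v t + (z₀ + ρ) * v t) t := fun t ht => by
    refine (((((dx t ht).pow 2).div_const 2).add ((dx t ht).const_mul (z₀ + ρ))).add_const
      y₀).congr_deriv ?_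
    push_cast
    ring
  have dγ : ∀ t ∈ I, HasDerivAt γ
      ![v t, q t, γ t 0 + z₀ + (γ t 0 * q t - v t * γ t 1) / 2] t := fun t ht => by
    refine hasDerivAt_pi.2 fun i => ?_
    fin_cases i
    exacts [dx t ht, dy t ht, dz t ht]
  have dγ' : ∀ t ∈ I, HasDerivAt (deriv γ) ![a t, γ t 0 * v t + (z₀ + ρ) * v t,
      v t + (γ t 0 * (γ t 0 * v t + (z₀ + ρ) * v t) - a t * γ t 1) / 2] t := fun t ht => by
    have h1 : HasDerivAt
        (fun t => ![v t, q t, γ t 0 + z₀ + (γ t 0 * q t - v t * γ t 1) / 2])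
        ![a t, γ t 0 * v t + (z₀ + ρ) * v t,
          v t + (γ t 0 * (γ t 0 * v t + (z₀ + ρ) * v t) - a t * γ t 1) / 2] t := by
      refine hasDerivAt_pi.2 fun i => ?_
      fin_cases i
      · exact dv t ht
      · exact dq t ht
      · refine (((dx t ht).add_const z₀).add ((((dx t ht).mul (dq t ht)).sub
          ((dv t ht).mul (dy t ht))).div_const 2)).congr_deriv ?_
        simp
        ring
    exact h1.congr_of_eventuallyEq (Filter.eventuallyEq_of_mem (hI.1.mem_nhds ht)
      fun s hs => (dγ s hs).deriv)
  have hy0 : γ 0 1 = 0 := by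
    rw [(hyz 0 hI.2.2).1, intervalIntegral.integral_same]
  have hz0 : γ 0 2 = 0 := by
    rw [(hyz 0 hI.2.2).2, hx0, hy0, hv0]
    ring
  refine ⟨fun t ht => ⟨(dγ t ht).differentiableAt, (dγ' t ht).differentiableAt, ?_⟩, ?_, ?_⟩
  · rw [(dγ' t ht).deriv, (dγ t ht).deriv, magnetic_equation_iff]
    simp [ha, hq, hFun]
    refine ⟨?_, ?_, ?_⟩ <;> ring
  · ext i
    fin_cases i
    exacts [hx0, hy0, hz0]
  · rw [(dγ 0 hI.2.2).deriv]
    simp [hq, hx0, hy0, hv0]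

end

/-! ### Roots of the quartic and the sign of its discriminant -/

section

open Polynomial

/-- Outside the degenerate case, the quartic takes positive values: otherwise the initial point
would be a maximum with value zero. -/
lemma exists_quartic_eval_pos {ρ x₀ y₀ z₀ : ℝ}
    (h : x₀ ^ 2 + (ρ - (y₀ + 1) * (z₀ + ρ)) ^ 2 ≠ 0) :
    ∃ η, 0 < (quartic ρ x₀ y₀ z₀).eval η := by
  by_contra! hle
  have h0 := quartic_eval_initial ρ x₀ y₀ z₀
  have hx : x₀ ^ 2 = 0 := le_antisymm (h0 ▸ hle _) (sq_nonneg _)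
  have hmax : IsLocalMax (fun η => (quartic ρ x₀ y₀ z₀).eval η) (z₀ + ρ) :=
    Filter.Eventually.of_forall fun η => by
      simp only [h0, hx]
      exact hle η
  have hd := hmax.hasDerivAt_eq_zero (hasDerivAt_quartic ρ x₀ y₀ z₀ (z₀ + ρ))
  simp only [hFun, sub_self] at hd
  refine h ?_
  have : ρ - (y₀ + 1) * (z₀ + ρ) = 0 := by linear_combination hd / 2
  rw [hx, this]
  ring

lemma monic_quartic_pos_of_large (p ρ q η : ℝ) (h : 1 + 2 * |p| + 8 * |ρ| + |q| ≤ |η|) :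
    0 < η ^ 4 + 2 * p * η ^ 2 - 8 * ρ * η + q := by
  set M := |η| with hM
  have hM1 : 1 ≤ M := by linarith [abs_nonneg p, abs_nonneg ρ, abs_nonneg q]
  have h2 : η ^ 2 = M ^ 2 := (sq_abs η).symm
  have h4 : η ^ 4 = M ^ 4 := by rw [show 4 = 2 * 2 by norm_num, pow_mul, h2, ← pow_mul]
  have e1 : -(|p| * M ^ 3) ≤ p * η ^ 2 := by
    rw [h2]
    have : M ^ 2 ≤ M ^ 3 := pow_le_pow_right₀ hM1 (by norm_num)
    nlinarith [neg_abs_le p, abs_nonneg p, sq_nonneg M]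
  have e2 : ρ * η ≤ |ρ| * M ^ 3 := by
    have h1 : ρ * η ≤ |ρ| * M := by rw [hM, ← abs_mul]; exact le_abs_self _
    have : M ≤ M ^ 3 := le_self_pow₀ hM1 (by norm_num)
    exact h1.trans (mul_le_mul_of_nonneg_left this (abs_nonneg _))
  have e3 : -(|q| * M ^ 3) ≤ q := by
    have : 1 ≤ M ^ 3 := one_le_pow₀ hM1
    nlinarith [neg_abs_le q, abs_nonneg q]
  have e4 : M ^ 3 * (1 + 2 * |p| + 8 * |ρ| + |q|) ≤ M ^ 3 * M :=
    mul_le_mul_of_nonneg_left h (by positivity)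
  have : 0 < M ^ 3 := by positivity
  rw [h4]
  nlinarith

/-- A quartic `-(η⁴ + 2 p η² - 8 ρ η + q) / 4` with a positive value has two distinct real roots. -/
lemma exists_two_roots {p ρ q η₀ : ℝ} (h : η₀ ^ 4 + 2 * p * η₀ ^ 2 - 8 * ρ * η₀ + q < 0) :
    ∃ a b : ℝ, a < η₀ ∧ η₀ < b ∧ a ^ 4 + 2 * p * a ^ 2 - 8 * ρ * a + q = 0 ∧
      b ^ 4 + 2 * p * b ^ 2 - 8 * ρ * b + q = 0 := by
  set Q : ℝ → ℝ := fun η => η ^ 4 + 2 * p * η ^ 2 - 8 * ρ * η + q with hQ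
  have hc : Continuous Q := by fun_prop
  set M := 1 + 2 * |p| + 8 * |ρ| + |q| + |η₀| with hM
  have hM0 : 0 ≤ M := by positivity
  have hMη : |η₀| < M := by linarith [abs_nonneg p, abs_nonneg ρ, abs_nonneg q]
  obtain ⟨hl, hr⟩ := abs_lt.1 hMη
  have hbig : 1 + 2 * |p| + 8 * |ρ| + |q| ≤ |M| := by
    rw [abs_of_nonneg hM0]
    linarith [abs_nonneg η₀]
  obtain ⟨a, ha, ha0⟩ := intermediate_value_Icc' hl.le hc.continuousOn
    (show (0 : ℝ) ∈ Icc (Q η₀) (Q (-M)) from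
      ⟨h.le, (monic_quartic_pos_of_large p ρ q (-M) (by rwa [abs_neg])).le⟩)
  obtain ⟨b, hb, hb0⟩ := intermediate_value_Icc hr.le hc.continuousOn
    (show (0 : ℝ) ∈ Icc (Q η₀) (Q M) from
      ⟨h.le, (monic_quartic_pos_of_large p ρ q M hbig).le⟩)
  refine ⟨a, b, lt_of_le_of_ne ha.2 ?_, lt_of_le_of_ne hb.1 ?_, ha0, hb0⟩
  · rintro rfl
    exact h.ne ha0
  · rintro rfl
    exact h.ne hb0

/-- Dividing by two distinct roots `a`, `b`: the other factor is `η² + (a + b) η + e`, and the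
coefficients are expressed through `a`, `b`, `e`. -/
lemma coefficients_of_two_roots {p ρ q a b : ℝ} (hab : a ≠ b)
    (ha : a ^ 4 + 2 * p * a ^ 2 - 8 * ρ * a + q = 0)
    (hb : b ^ 4 + 2 * p * b ^ 2 - 8 * ρ * b + q = 0) :
    ∃ e, p = (e + a * b - (a + b) ^ 2) / 2 ∧ ρ = (a + b) * (e - a * b) / 8 ∧ q = a * b * e := by
  have hρ : 8 * ρ = (a + b) * (a ^ 2 + b ^ 2) + 2 * p * (a + b) := by
    refine mul_left_cancel₀ (sub_ne_zero.2 hab) ?_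
    linear_combination hb - ha
  refine ⟨2 * p - a * b + (a + b) ^ 2, by ring, by linear_combination hρ / 8, ?_⟩
  linear_combination ha + a * hρ

/-- The discriminant in terms of two roots and the complementary quadratic factor. -/
lemma discPoly_eq (a b e : ℝ) :
    256 * discPoly ((a + b) * (e - a * b) / 8) ((e + a * b - (a + b) ^ 2) / 2) (a * b * e)
      = (a - b) ^ 2 * ((a + b) ^ 2 - 4 * e)
        * ((a ^ 2 + (a + b) * a + e) * (b ^ 2 + (a + b) * b + e)) ^ 2 := by
  rw [discPoly]
  ring

lemma exists_factorization {ρ x₀ y₀ z₀ : ℝ}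
    (h : x₀ ^ 2 + (ρ - (y₀ + 1) * (z₀ + ρ)) ^ 2 ≠ 0) :
    ∃ a b e : ℝ, a < b ∧ pZero ρ y₀ z₀ = (e + a * b - (a + b) ^ 2) / 2 ∧
      ρ = (a + b) * (e - a * b) / 8 ∧ qZero ρ x₀ y₀ z₀ = a * b * e := by
  obtain ⟨η, hη⟩ := exists_quartic_eval_pos h
  rw [quartic_eval] at hη
  obtain ⟨a, b, ha, hb, ha0, hb0⟩ := exists_two_roots (p := pZero ρ y₀ z₀) (ρ := ρ)
    (q := qZero ρ x₀ y₀ z₀) (η₀ := η) (by linarith)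
  obtain ⟨e, h1, h2, h3⟩ := coefficients_of_two_roots (ha.trans hb).ne ha0 hb0
  exact ⟨a, b, e, ha.trans hb, h1, h2, h3⟩

lemma exists_roots_of_disc_neg {ρ x₀ y₀ z₀ : ℝ}
    (h : x₀ ^ 2 + (ρ - (y₀ + 1) * (z₀ + ρ)) ^ 2 ≠ 0)
    (hΔ : discPoly ρ (pZero ρ y₀ z₀) (qZero ρ x₀ y₀ z₀) < 0) :
    ∃ r₁ r₄ α β : ℝ, r₁ < r₄ ∧ β ≠ 0 ∧
      ∀ z : ℂ, ((quartic ρ x₀ y₀ z₀).map (algebraMap ℝ ℂ)).eval z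
        = -((z - r₁) * (z - r₄) * ((z - α) ^ 2 + β ^ 2)) / 4 := by
  obtain ⟨a, b, e, hab, hp, hρ, hq⟩ := exists_factorization h
  have hd := discPoly_eq a b e
  rw [← hp, ← hρ, ← hq] at hd
  have hneg : (a + b) ^ 2 - 4 * e < 0 := by
    by_contra! hge
    have : 0 ≤ (a - b) ^ 2 * ((a + b) ^ 2 - 4 * e)
        * ((a ^ 2 + (a + b) * a + e) * (b ^ 2 + (a + b) * b + e)) ^ 2 := by positivity
    linarith
  refine ⟨a, b, -(a + b) / 2, √(4 * e - (a + b) ^ 2) / 2, hab,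
    (div_pos (Real.sqrt_pos.2 (by linarith)) two_pos).ne', fun z => ?_⟩
  have hs : ((√(4 * e - (a + b) ^ 2) : ℝ) : ℂ) ^ 2 = 4 * e - (a + b) ^ 2 := by
    rw [← Complex.ofReal_pow, Real.sq_sqrt (by linarith)]
    push_cast
    ring
  have heval : ((quartic ρ x₀ y₀ z₀).map (algebraMap ℝ ℂ)).eval z
      = -(z ^ 4 + 2 * (pZero ρ y₀ z₀ : ℂ) * z ^ 2 - 8 * (ρ : ℂ) * z
        + (qZero ρ x₀ y₀ z₀ : ℂ)) / 4 := by
    simp [quartic, qZero, pZero]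
    ring
  have hp' : (pZero ρ y₀ z₀ : ℂ) = (e + a * b - (a + b) ^ 2) / 2 := by rw [hp]; push_cast; rfl
  have hρ' : (ρ : ℂ) = (a + b) * (e - a * b) / 8 := by
    conv_lhs => rw [hρ]
    push_cast
    rfl
  have hq' : (qZero ρ x₀ y₀ z₀ : ℂ) = a * b * e := by rw [hq]; push_cast; rfl
  rw [heval, hp', hρ', hq']
  push_cast
  linear_combination (z - a) * (z - b) / 16 * hs

lemma exists_sorted_of_distinct {a b c d : ℝ} (hab : a < b) (hcd : c < d) (hac : a ≠ c)
    (had : a ≠ d) (hbc : b ≠ c) (hbd : b ≠ d) :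
    ∃ r₁ r₂ r₃ r₄ : ℝ, r₁ < r₂ ∧ r₂ < r₃ ∧ r₃ < r₄ ∧ ∀ x : ℝ,
      (x - a) * (x - b) * ((x - c) * (x - d))
        = (x - r₁) * (x - r₂) * (x - r₃) * (x - r₄) := by
  rcases hac.lt_or_gt with h1 | h1
  · rcases hbc.lt_or_gt with h2 | h2
    · exact ⟨a, b, c, d, hab, h2, hcd, fun x => by ring⟩
    · rcases hbd.lt_or_gt with h3 | h3
      · exact ⟨a, c, b, d, h1, h2, h3, fun x => by ring⟩
      · exact ⟨a, c, d, b, h1, hcd, h3, fun x => by ring⟩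
  · rcases had.lt_or_gt with h2 | h2
    · rcases hbd.lt_or_gt with h3 | h3
      · exact ⟨c, a, b, d, h1, hab, h3, fun x => by ring⟩
      · exact ⟨c, a, d, b, h1, h2, h3, fun x => by ring⟩
    · exact ⟨c, d, a, b, hcd, h2, hab, fun x => by ring⟩

lemma exists_roots_of_disc_pos {ρ x₀ y₀ z₀ : ℝ}
    (h : x₀ ^ 2 + (ρ - (y₀ + 1) * (z₀ + ρ)) ^ 2 ≠ 0)
    (hΔ : 0 < discPoly ρ (pZero ρ y₀ z₀) (qZero ρ x₀ y₀ z₀)) :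
    ∃ r₁ r₂ r₃ r₄ : ℝ, r₁ < r₂ ∧ r₂ < r₃ ∧ r₃ < r₄ ∧ ∀ η : ℝ, (quartic ρ x₀ y₀ z₀).eval η
        = -((η - r₁) * (η - r₂) * (η - r₃) * (η - r₄)) / 4 := by
  obtain ⟨a, b, e, hab, hp, hρ, hq⟩ := exists_factorization h
  have hd := discPoly_eq a b e
  rw [← hp, ← hρ, ← hq] at hd
  have hpos : 0 < (a + b) ^ 2 - 4 * e := by
    by_contra! hle
    have : (a - b) ^ 2 * ((a + b) ^ 2 - 4 * e)
        * ((a ^ 2 + (a + b) * a + e) * (b ^ 2 + (a + b) * b + e)) ^ 2 ≤ 0 :=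
      mul_nonpos_of_nonpos_of_nonneg (mul_nonpos_of_nonneg_of_nonpos (sq_nonneg _) hle)
        (sq_nonneg _)
    linarith
  have hne : (a ^ 2 + (a + b) * a + e) * (b ^ 2 + (a + b) * b + e) ≠ 0 := fun h0 => by
    rw [h0] at hd
    linarith
  set s := √((a + b) ^ 2 - 4 * e) with hs
  have hs0 : 0 < s := Real.sqrt_pos.2 hpos
  have hs2 : s ^ 2 = (a + b) ^ 2 - 4 * e := Real.sq_sqrt hpos.le
  have hquad : ∀ x, x ^ 2 + (a + b) * x + e
      = (x - (-(a + b) - s) / 2) * (x - (-(a + b) + s) / 2) := fun x => by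
    linear_combination hs2 / 4
  rw [hquad, hquad] at hne
  have h1 := mul_ne_zero_iff.1 hne
  have h2 := mul_ne_zero_iff.1 h1.1
  have h3 := mul_ne_zero_iff.1 h1.2
  obtain ⟨r₁, r₂, r₃, r₄, h12, h23, h34, hr⟩ := exists_sorted_of_distinct hab
    (show (-(a + b) - s) / 2 < (-(a + b) + s) / 2 by linarith)
    (sub_ne_zero.1 h2.1) (sub_ne_zero.1 h2.2) (sub_ne_zero.1 h3.1) (sub_ne_zero.1 h3.2)
  refine ⟨r₁, r₂, r₃, r₄, h12, h23, h34, fun η => ?_⟩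
  rw [← hr, ← hquad, quartic_eval, hp, hq]
  linear_combination 2 * η * hρ

/-- If the discriminant vanishes, there is a real double root `r`, and the other two roots
`-r ± √(-2 (p + r²))` are real and distinct. -/
lemma exists_double_root {ρ x₀ y₀ z₀ : ℝ}
    (h : x₀ ^ 2 + (ρ - (y₀ + 1) * (z₀ + ρ)) ^ 2 ≠ 0)
    (hΔ : discPoly ρ (pZero ρ y₀ z₀) (qZero ρ x₀ y₀ z₀) = 0) :
    ∃ r : ℝ, ρ = r * (pZero ρ y₀ z₀ + r ^ 2) / 2 ∧
      qZero ρ x₀ y₀ z₀ = r ^ 2 * (2 * pZero ρ y₀ z₀ + 3 * r ^ 2) ∧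
      pZero ρ y₀ z₀ + r ^ 2 < 0 := by
  obtain ⟨a, b, e, hab, hp, hρ, hq⟩ := exists_factorization h
  have hd := discPoly_eq a b e
  rw [← hp, ← hρ, ← hq, hΔ, mul_zero] at hd
  obtain ⟨r, h1, h2⟩ : ∃ r : ℝ, ρ = r * (pZero ρ y₀ z₀ + r ^ 2) / 2 ∧
      qZero ρ x₀ y₀ z₀ = r ^ 2 * (2 * pZero ρ y₀ z₀ + 3 * r ^ 2) := by
    rw [hp, hq]
    have h0 : (a - b) ^ 2 ≠ 0 := pow_ne_zero 2 (sub_ne_zero.2 hab.ne)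
    rcases mul_eq_zero.1 hd.symm with h1 | h1
    · have he : (a + b) ^ 2 - 4 * e = 0 := (mul_eq_zero.1 h1).resolve_left h0
      obtain rfl : e = (a + b) ^ 2 / 4 := by linarith
      exact ⟨-(a + b) / 2, by rw [hρ]; ring, by ring⟩
    · rcases mul_eq_zero.1 (pow_eq_zero_iff two_ne_zero |>.1 h1) with h2 | h2
      · obtain rfl : e = -(a ^ 2 + (a + b) * a) := by linarith
        exact ⟨a, by rw [hρ]; ring, by ring⟩
      · obtain rfl : e = -(b ^ 2 + (a + b) * b) := by linarith
        exact ⟨b, by rw [hρ]; ring, by ring⟩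
  refine ⟨r, h1, h2, ?_⟩
  obtain ⟨η, hη⟩ := exists_quartic_eval_pos h
  have hf : (quartic ρ x₀ y₀ z₀).eval η
      = -((η - r) ^ 2 * ((η + r) ^ 2 + 2 * (pZero ρ y₀ z₀ + r ^ 2))) / 4 := by
    rw [quartic_eval, h2]
    linear_combination 2 * η * h1
  rw [hf] at hη
  by_contra! hge
  have : 0 ≤ (η - r) ^ 2 * ((η + r) ^ 2 + 2 * (pZero ρ y₀ z₀ + r ^ 2)) := by positivity
  linarith

lemma roots_of_eval_eq {K : Type*} [Field K] [Infinite K] {P : K[X]} {l a b c d : K}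
    (hl : l ≠ 0)
    (h : ∀ x, P.eval x = l * ((x - a) * (x - b) * (x - c) * (x - d))) :
    P.roots = {a, b, c, d} := by
  have hP : P = C l * (Multiset.map (fun r => X - C r) {a, b, c, d}).prod :=
    Polynomial.funext fun x => by
      rw [h]
      simp [hl]
      ring
  rw [hP, roots_C_mul _ hl, roots_multiset_prod_X_sub_C]

lemma rootMultiplicity_of_eval_eq {P G : ℝ[X]} {r : ℝ} {n : ℕ} (hG : G.eval r ≠ 0)
    (h : ∀ x, P.eval x = G.eval x * (x - r) ^ n) : P.rootMultiplicity r = n := by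
  have hP : P = G * (X - C r) ^ n := Polynomial.funext fun x => by
    rw [h]
    simp
  have hG0 : G ≠ 0 := by
    rintro rfl
    simp at hG
  rw [hP, rootMultiplicity_mul_X_sub_C_pow hG0, rootMultiplicity_eq_zero hG, zero_add]

lemma cubeRoot_neg_pow_three (r : ℝ) : cubeRoot (-r ^ 3) = -r := by
  have habs : |(-r ^ 3)| ^ ((1 : ℝ) / 3) = |r| := by
    rw [abs_neg, abs_pow, ← Real.rpow_natCast, ← Real.rpow_mul (abs_nonneg r)]
    norm_num
  rw [cubeRoot, habs]
  rcases lt_trichotomy r 0 with h | rfl | h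
  · have : 0 < -r ^ 3 := by
      have := Odd.pow_neg (by decide : Odd 3) h
      linarith
    rw [Real.sign_of_pos this, abs_of_neg h, one_mul]
  · simp
  · have : -r ^ 3 < 0 := by
      have := pow_pos h 3
      linarith
    rw [Real.sign_of_neg this, abs_of_pos h]
    ring

end

/-! ### Four distinct roots: elliptic functions -/

section

variable {ρ x₀ y₀ z₀ : ℝ}

lemma jacobiAm_affine {k ω : ℝ} (hk : k ^ 2 < 1) (hω : 0 < ω) (C : ℝ) :
    StrictMono (fun t => jacobiAm (ω * t + C) k) ∧
      Function.Surjective (fun t => jacobiAm (ω * t + C) k) := by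
  refine ⟨fun s t hst => strictMono_jacobiAm hk ?_, fun φ => ?_⟩
  · have := mul_lt_mul_of_pos_left hst hω
    linarith
  · obtain ⟨u, hu⟩ := surjective_jacobiAm hk φ
    refine ⟨(u - C) / ω, ?_⟩
    simp only
    rw [mul_div_cancel₀ _ hω.ne', sub_add_cancel]
    exact hu

lemma hasDerivAt_comp_affine {f : ℝ → ℝ} {f' ω C t : ℝ} (hf : HasDerivAt f f' (ω * t + C)) :
    HasDerivAt (fun t => f (ω * t + C)) (ω * f') t := by
  have h : HasDerivAt (fun t => ω * t + C) ω t := by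
    simpa using ((hasDerivAt_id t).const_mul ω).add_const C
  exact (hf.comp t h).congr_deriv (mul_comm _ _)

lemma modulusCn_sq {r₁ r₄ α β d₁ d₄ : ℝ} (hβ : β ≠ 0) (hr : r₁ < r₄) (hd₁ : 0 < d₁)
    (hd₄ : 0 < d₄) (h₁ : d₁ ^ 2 = (r₁ - α) ^ 2 + β ^ 2) (h₄ : d₄ ^ 2 = (r₄ - α) ^ 2 + β ^ 2) :
    modulusCn r₁ r₄ d₁ d₄ ^ 2 * (4 * d₄ * d₁) = (r₄ - r₁) ^ 2 - (d₄ - d₁) ^ 2 ∧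
      0 < modulusCn r₁ r₄ d₁ d₄ ∧ modulusCn r₁ r₄ d₁ d₄ < 1 := by
  -- `d₁ d₄` exceeds the scalar product of the vectors from `r₂` to `r₁` and `r₄`, and its opposite
  have hcs : ((r₁ - α) * (r₄ - α) + β ^ 2) ^ 2 < (d₁ * d₄) ^ 2 := by
    rw [mul_pow, h₁, h₄]
    have : 0 < (β * (r₄ - r₁)) ^ 2 := by
      have := mul_ne_zero hβ (sub_pos.2 hr).ne'
      positivity
    linarith
  obtain ⟨hl, hu⟩ := abs_lt_of_sq_lt_sq' hcs (by positivity)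
  have hnum : 0 < (r₄ - r₁) ^ 2 - (d₄ - d₁) ^ 2 := by nlinarith
  have hden : 0 < 4 * d₄ * d₁ := by positivity
  have hpos := div_pos hnum hden
  refine ⟨?_, Real.sqrt_pos.2 hpos, ?_⟩
  · rw [modulusCn, Real.sq_sqrt hpos.le, div_mul_cancel₀ _ hden.ne']
  · rw [modulusCn, Real.sqrt_lt' one_pos, one_pow, div_lt_one hden]
    nlinarith

/-- Two real roots `r₁ < r₄` and two non-real roots `α ± β i`. The substitution
`(η - r₁) / (r₄ - η) = d₁ (1 - cn) / (d₄ (1 + cn))` is a Möbius transformation. -/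
lemma solCn_spec {r₁ r₄ α β d₁ d₄ k : ℝ} (hx₀ : 0 ≤ x₀) (hβ : β ≠ 0) (hr : r₁ < r₄)
    (hd₁ : 0 < d₁) (hd₄ : 0 < d₄) (h₁ : d₁ ^ 2 = (r₁ - α) ^ 2 + β ^ 2)
    (h₄ : d₄ ^ 2 = (r₄ - α) ^ 2 + β ^ 2)
    (hP : ∀ η, (quartic ρ x₀ y₀ z₀).eval η
      = -((η - r₁) * (η - r₄) * ((η - α) ^ 2 + β ^ 2)) / 4)
    (hk : k = modulusCn r₁ r₄ d₁ d₄) :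
    0 < k ∧ k < 1 ∧ IsTheSolution ρ x₀ y₀ z₀ (solCn (z₀ + ρ) r₁ r₄ d₁ d₄) ∧
      HasPeriod (solCn (z₀ + ρ) r₁ r₄ d₁ d₄) (8 * ellipticK k / √(d₁ * d₄)) ∧
      range (solCn (z₀ + ρ) r₁ r₄ d₁ d₄) = Icc (r₁ - (z₀ + ρ)) (r₄ - (z₀ + ρ)) := by
  obtain ⟨hk2, hk0, hk1⟩ := modulusCn_sq hβ hr hd₁ hd₄ h₁ h₄
  set c := z₀ + ρ with hc
  rw [← hk] at hk2 hk0 hk1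
  have hksq : k ^ 2 < 1 := by nlinarith
  obtain ⟨hc₁, hc₄⟩ : r₁ ≤ c ∧ c ≤ r₄ := by
    have h0 := quartic_eval_initial ρ x₀ y₀ z₀
    rw [hP, ← hc] at h0
    have hq : 0 < (c - α) ^ 2 + β ^ 2 := by positivity
    have hle : (c - r₁) * (c - r₄) ≤ 0 := by
      by_contra! hlt
      nlinarith [mul_pos hlt hq, sq_nonneg x₀]
    constructor <;> by_contra! hlt <;> nlinarith
  set S := (r₄ - c) * d₁ + (c - r₁) * d₄ with hS
  have hS0 : 0 < S := by
    rcases hc₁.lt_or_eq with h | h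
    · have : 0 ≤ (r₄ - c) * d₁ := mul_nonneg (by linarith) hd₁.le
      have : 0 < (c - r₁) * d₄ := mul_pos (by linarith) hd₄
      linarith
    · have : 0 < (r₄ - c) * d₁ := mul_pos (by linarith) hd₁
      have : 0 ≤ (c - r₁) * d₄ := mul_nonneg (by linarith) hd₄.le
      linarith
  set s₀ := ((r₄ - c) * d₁ - (c - r₁) * d₄) / S with hs₀
  have hs₀S : s₀ * S = (r₄ - c) * d₁ - (c - r₁) * d₄ := div_mul_cancel₀ _ hS0.ne'
  have hs1 : -1 ≤ s₀ := by
    rw [hs₀, le_div_iff₀ hS0]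
    have := mul_nonneg (sub_nonneg.2 hc₄) hd₁.le
    linarith
  have hs2 : s₀ ≤ 1 := by
    rw [hs₀, div_le_one hS0]
    have := mul_nonneg (sub_nonneg.2 hc₁) hd₄.le
    linarith
  set C₁ := jacobiArccn s₀ k with hC₁
  set ω := √(d₁ * d₄) / 2 with hω
  have hω0 : 0 < ω := by positivity
  have hω2 : ω ^ 2 = d₁ * d₄ / 4 := by
    rw [hω, div_pow, Real.sq_sqrt (by positivity)]
    norm_num
  have hX : solCn c r₁ r₄ d₁ d₄ = fun t =>
      ((r₁ * d₄ - r₄ * d₁) * jacobiCn (ω * t + C₁) k + (r₁ * d₄ + r₄ * d₁))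
        / ((d₄ - d₁) * jacobiCn (ω * t + C₁) k + (d₁ + d₄)) - c := funext fun t => by
    simp only [solCn, ← hk, ← hS, ← hs₀, ← hC₁, ← hω, add_assoc]
  have hden : ∀ y ∈ Icc (-1 : ℝ) 1, 0 < (d₄ - d₁) * y + (d₁ + d₄) := fun y hy => by
    have e1 := mul_nonneg hd₁.le (sub_nonneg.2 hy.2)
    have e2 := mul_nonneg hd₄.le (by linarith [hy.1] : 0 ≤ 1 + y)
    rcases lt_or_ge 0 y with h | h
    · have := mul_pos hd₄ h
      linarith
    · have := mul_nonneg hd₁.le (neg_nonneg.2 h)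
      linarith
  have hdet : (r₁ * d₄ - r₄ * d₁) * (d₁ + d₄) - (r₁ * d₄ + r₄ * d₁) * (d₄ - d₁) < 0 := by
    have := mul_pos (mul_pos hd₁ hd₄) (sub_pos.2 hr)
    linarith
  refine ⟨hk0, hk1, ?_, ?_⟩
  · rw [hX]
    refine isTheSolution_moebius hx₀ (w := fun t => jacobiCn (ω * t + C₁) k)
      (v := fun t => ω * (-jacobiSn (ω * t + C₁) k * jacobiDn (ω * t + C₁) k))
      (A := fun y => ω ^ 2 * ((1 - y ^ 2) * (1 - k ^ 2 + k ^ 2 * y ^ 2)))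
      (A₁ := fun y => ω ^ 2 * (-(2 * y) * (1 - k ^ 2 + k ^ 2 * y ^ 2)
        + (1 - y ^ 2) * (2 * k ^ 2 * y))) _ _ _ _ ?_ ?_ ?_ ?_ ?_ hdet.ne ?_ ?_ ?_
    · intro y
      have := ((((hasDerivAt_id y).pow 2).const_sub 1).mul
        ((((hasDerivAt_id y).pow 2).const_mul (k ^ 2)).const_add (1 - k ^ 2))).const_mul (ω ^ 2)
      refine this.congr_deriv ?_
      simp only [Pi.pow_apply, id]
      push_cast
      ring
    · exact fun t => hasDerivAt_comp_affine (hasDerivAt_jacobiCn hksq _)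
    · intro t
      have h := (hasDerivAt_comp_affine (f := fun u => -jacobiSn u k * jacobiDn u k) (ω := ω)
        (C := C₁) (t := t) ((hasDerivAt_jacobiSn hksq _).neg.mul
          (hasDerivAt_jacobiDn hksq _))).const_mul ω
      refine h.congr_deriv ?_
      set u := ω * t + C₁
      have e1 := jacobiDn_sq hksq u
      have e2 := jacobiSn_sq u k
      simp only [Pi.neg_apply]
      linear_combination (-(ω ^ 2) * jacobiCn u k) * e1 + 2 * ω ^ 2 * k ^ 2 * jacobiCn u k * e2
    · intro t
      set u := ω * t + C₁
      rw [mul_pow, mul_pow, jacobiDn_sq hksq, neg_sq, jacobiSn_sq]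
      ring
    · exact fun t => (hden _ (Real.cos_mem_Icc _)).ne'
    · intro y hy
      set D := (d₄ - d₁) * y + (d₁ + d₄) with hD
      set N := (r₁ * d₄ - r₄ * d₁) * y + (r₁ * d₄ + r₄ * d₁) with hN
      have hclear : (quartic ρ x₀ y₀ z₀).eval (N / D) * D ^ 4
          = -((N - r₁ * D) * (N - r₄ * D) * ((N - α * D) ^ 2 + β ^ 2 * D ^ 2)) / 4 := by
        rw [hP]
        field_simp
      have e1 : N - r₁ * D = d₁ * (r₄ - r₁) * (1 - y) := by rw [hN, hD]; ring
      have e4 : N - r₄ * D = -(d₄ * (r₄ - r₁) * (1 + y)) := by rw [hN, hD]; ring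
      have e2 : (N - α * D) ^ 2 + β ^ 2 * D ^ 2
          = 4 * (d₁ * d₄) ^ 2 * (1 - (1 - y ^ 2) * k ^ 2) := by
        rw [hN, hD]
        linear_combination (-(d₄ ^ 2 * (1 + y) ^ 2) - d₁ * d₄ * (1 - y ^ 2)) * h₁
          + (-(d₁ ^ 2 * (1 - y) ^ 2) - d₁ * d₄ * (1 - y ^ 2)) * h₄
          + d₁ * d₄ * (1 - y ^ 2) * hk2
      rw [hclear, e1, e4, e2, hω2]
      ring
    · simp only [mul_zero, zero_add]
      rw [hC₁, jacobiCn_jacobiArccn hksq hs1 hs2,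
        div_eq_iff (hden s₀ ⟨hs1, hs2⟩).ne']
      linear_combination -hs₀S
    · have hsn := jacobiSn_jacobiArccn_nonneg hksq s₀
      have hdn := jacobiDn_pos hksq C₁
      simp only [mul_zero, zero_add]
      rw [← hC₁] at hsn
      have h := mul_nonneg (neg_nonneg.2 hdet.le)
        (by positivity : 0 ≤ ω * (jacobiSn C₁ k * jacobiDn C₁ k))
      refine h.trans_eq ?_
      ring
  · have hω' : 8 * ellipticK k / √(d₁ * d₄) = 4 * ellipticK k / ω := by
      rw [hω]
      field_simp
      ring
    obtain ⟨hm, hs⟩ := jacobiAm_affine hksq hω0 C₁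
    have hT : ∀ t, jacobiAm (ω * (t + 4 * ellipticK k / ω) + C₁) k
        = jacobiAm (ω * t + C₁) k + 2 * Real.pi := fun t => by
      rw [show ω * (t + 4 * ellipticK k / ω) + C₁
          = ω * t + C₁ + 2 * ellipticK k + 2 * ellipticK k by field_simp; ring,
        jacobiAm_add_two_mul_ellipticK hksq, jacobiAm_add_two_mul_ellipticK hksq]
      ring
    have h := period_range_moebius_cos hm hs hT c hden hdet
    rw [hX, hω']
    refine ⟨h.1, h.2.trans ?_⟩
    congr 2
    · rw [div_eq_iff (by linarith)]
      ring
    · rw [div_eq_iff (by linarith)]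
      ring

/-- Squares of `sn` obey a one-dimensional energy equation. -/
lemma energy_jacobiSn_sq {k : ℝ} (hk : k ^ 2 < 1) (ω C : ℝ) :
    (∀ y, HasDerivAt (fun y => 4 * ω ^ 2 * (y * (1 - y) * (1 - k ^ 2 * y)))
      (4 * ω ^ 2 * ((1 - y) * (1 - k ^ 2 * y) - y * (1 - k ^ 2 * y) - k ^ 2 * y * (1 - y))) y) ∧
    (∀ t, HasDerivAt (fun t => jacobiSn (ω * t + C) k ^ 2)
      (2 * ω * (jacobiSn (ω * t + C) k * jacobiCn (ω * t + C) k * jacobiDn (ω * t + C) k)) t) ∧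
    (∀ t, HasDerivAt (fun t => 2 * ω * (jacobiSn (ω * t + C) k * jacobiCn (ω * t + C) k
        * jacobiDn (ω * t + C) k))
      ((fun y => 4 * ω ^ 2 * ((1 - y) * (1 - k ^ 2 * y) - y * (1 - k ^ 2 * y)
        - k ^ 2 * y * (1 - y))) (jacobiSn (ω * t + C) k ^ 2) / 2) t) ∧
    ∀ t, (2 * ω * (jacobiSn (ω * t + C) k * jacobiCn (ω * t + C) k
        * jacobiDn (ω * t + C) k)) ^ 2
      = (fun y => 4 * ω ^ 2 * (y * (1 - y) * (1 - k ^ 2 * y))) (jacobiSn (ω * t + C) k ^ 2) := by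
  refine ⟨fun y => ?_, fun t => ?_, fun t => ?_, fun t => ?_⟩
  · have := (((hasDerivAt_id y).mul ((hasDerivAt_id y).const_sub 1)).mul
      (((hasDerivAt_id y).const_mul (k ^ 2)).const_sub 1)).const_mul (4 * ω ^ 2)
    refine this.congr_deriv ?_
    simp only [Pi.mul_apply, id]
    ring
  · refine ((hasDerivAt_comp_affine (hasDerivAt_jacobiSn hk _)).pow 2).congr_deriv ?_
    push_cast
    ring
  · have h := (hasDerivAt_comp_affine (f := fun u => jacobiSn u k * jacobiCn u k * jacobiDn u k)
      (ω := ω) (C := C) (t := t) (((hasDerivAt_jacobiSn hk _).mul (hasDerivAt_jacobiCn hk _)).mul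
        (hasDerivAt_jacobiDn hk _))).const_mul (2 * ω)
    refine h.congr_deriv ?_
    set u := ω * t + C
    have e1 := jacobiDn_sq hk u
    have e2 : jacobiCn u k ^ 2 = 1 - jacobiSn u k ^ 2 := by rw [jacobiSn_sq]; ring
    simp only [Pi.mul_apply]
    linear_combination 2 * ω ^ 2 * (jacobiCn u k ^ 2 - jacobiSn u k ^ 2) * e1
      + 2 * ω ^ 2 * (1 - 2 * k ^ 2 * jacobiSn u k ^ 2) * e2
  · simp only
    set u := ω * t + C
    have e2 : jacobiCn u k ^ 2 = 1 - jacobiSn u k ^ 2 := by rw [jacobiSn_sq]; ring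
    rw [mul_pow, mul_pow, mul_pow, mul_pow, jacobiDn_sq hk, e2]
    ring

/-- Twice the amplitude gains `2π` in time `2K / ω`, and `sn²` is an affine function of its
cosine. -/
lemma two_mul_jacobiAm_affine {k ω : ℝ} (hk : k ^ 2 < 1) (hω : 0 < ω) (C : ℝ) :
    StrictMono (fun t => 2 * jacobiAm (ω * t + C) k) ∧
      Function.Surjective (fun t => 2 * jacobiAm (ω * t + C) k) ∧
      (∀ t, 2 * jacobiAm (ω * (t + 2 * ellipticK k / ω) + C) k
        = 2 * jacobiAm (ω * t + C) k + 2 * Real.pi) ∧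
      ∀ t, jacobiSn (ω * t + C) k ^ 2 = 1 / 2 - Real.cos (2 * jacobiAm (ω * t + C) k) / 2 := by
  obtain ⟨hm, hs⟩ := jacobiAm_affine hk hω C
  refine ⟨fun s t hst => mul_lt_mul_of_pos_left (hm hst) two_pos, fun φ => ?_, fun t => ?_,
    fun t => Real.sin_sq_eq_half_sub _⟩
  · obtain ⟨t, ht⟩ := hs (φ / 2)
    exact ⟨t, by simp only at ht ⊢; rw [ht]; ring⟩
  · rw [show ω * (t + 2 * ellipticK k / ω) + C = ω * t + C + 2 * ellipticK k by
      field_simp; ring, jacobiAm_add_two_mul_ellipticK hk]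
    ring

lemma modulusSn_sq {r₁ r₂ r₃ r₄ : ℝ} (h₁₂ : r₁ < r₂) (h₂₃ : r₂ < r₃) (h₃₄ : r₃ < r₄) :
    modulusSn r₁ r₂ r₃ r₄ ^ 2 * ((r₄ - r₂) * (r₃ - r₁)) = (r₄ - r₃) * (r₂ - r₁) ∧
      0 < modulusSn r₁ r₂ r₃ r₄ ∧ modulusSn r₁ r₂ r₃ r₄ < 1 := by
  have hnum : 0 < (r₄ - r₃) * (r₂ - r₁) := mul_pos (by linarith) (by linarith)
  have hden : 0 < (r₄ - r₂) * (r₃ - r₁) := mul_pos (by linarith) (by linarith)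
  have hpos := div_pos hnum hden
  refine ⟨?_, Real.sqrt_pos.2 hpos, ?_⟩
  · rw [modulusSn, Real.sq_sqrt hpos.le, div_mul_cancel₀ _ hden.ne']
  · rw [modulusSn, Real.sqrt_lt' one_pos, one_pow, div_lt_one hden]
    have := mul_pos (by linarith : 0 < r₄ - r₁) (by linarith : 0 < r₃ - r₂)
    linarith

/-- Four real roots, the motion taking place between the two smallest ones. -/
lemma solSnLow_spec {r₁ r₂ r₃ r₄ k : ℝ} (hx₀ : 0 ≤ x₀) (h₁₂ : r₁ < r₂) (h₂₃ : r₂ < r₃)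
    (h₃₄ : r₃ < r₄)
    (hP : ∀ η, (quartic ρ x₀ y₀ z₀).eval η
      = -((η - r₁) * (η - r₂) * (η - r₃) * (η - r₄)) / 4)
    (hk : k = modulusSn r₁ r₂ r₃ r₄) (hc₁ : r₁ ≤ z₀ + ρ) (hc₂ : z₀ + ρ ≤ r₂) :
    IsTheSolution ρ x₀ y₀ z₀ (solSnLow (z₀ + ρ) r₁ r₂ r₃ r₄) ∧
      HasPeriod (solSnLow (z₀ + ρ) r₁ r₂ r₃ r₄)
        (8 * ellipticK k / √((r₄ - r₂) * (r₃ - r₁))) ∧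
      range (solSnLow (z₀ + ρ) r₁ r₂ r₃ r₄) = Icc (r₁ - (z₀ + ρ)) (r₂ - (z₀ + ρ)) := by
  obtain ⟨hk2, hk0, hk1⟩ := modulusSn_sq h₁₂ h₂₃ h₃₄
  set c := z₀ + ρ with hc
  rw [← hk] at hk2 hk0 hk1
  have hksq : k ^ 2 < 1 := by nlinarith
  have h21 : 0 < r₂ - r₁ := by linarith
  have h42 : 0 < r₄ - r₂ := by linarith
  have h31 : 0 < r₃ - r₁ := by linarith
  have h41 : 0 < r₄ - r₁ := by linarith
  have h4c : 0 < r₄ - c := by linarith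
  set a₀ := (r₄ - r₂) * (c - r₁) / ((r₂ - r₁) * (r₄ - c)) with ha₀
  have ha0 : 0 ≤ a₀ := div_nonneg (mul_nonneg h42.le (by linarith)) (by positivity)
  have ha1 : √a₀ ≤ 1 := by
    rw [Real.sqrt_le_one, ha₀, div_le_one (by positivity)]
    have := mul_nonneg (sub_nonneg.2 hc₂) h41.le
    linarith
  set C₂ := jacobiArcsn (√a₀) k with hC₂
  set ω := √((r₄ - r₂) * (r₃ - r₁)) / 4 with hω
  have hω0 : 0 < ω := by positivity
  have hω2 : ω ^ 2 = (r₄ - r₂) * (r₃ - r₁) / 16 := by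
    rw [hω, div_pow, Real.sq_sqrt (by positivity)]
    norm_num
  have hden : ∀ y, 0 ≤ y → 0 < (r₂ - r₁) * y + (r₄ - r₂) := fun y hy => by positivity
  have hX : solSnLow c r₁ r₂ r₃ r₄ = fun t =>
      (r₄ * (r₂ - r₁) * jacobiSn (ω * t + C₂) k ^ 2 + r₁ * (r₄ - r₂))
        / ((r₂ - r₁) * jacobiSn (ω * t + C₂) k ^ 2 + (r₄ - r₂)) - c := funext fun t => by
    simp only [solSnLow, ← hk, ← ha₀, ← hC₂, ← hω]
    set u := jacobiSn (ω * t + C₂) k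
    have := hden (u ^ 2) (sq_nonneg u)
    have h1 : 1 + (r₂ - r₁) / (r₄ - r₂) * u ^ 2
        = ((r₂ - r₁) * u ^ 2 + (r₄ - r₂)) / (r₄ - r₂) := by
      field_simp
      ring
    rw [h1]
    field_simp
    ring
  have hdet : 0 < r₄ * (r₂ - r₁) * (r₄ - r₂) - r₁ * (r₄ - r₂) * (r₂ - r₁) := by
    have := mul_pos (mul_pos h41 h21) h42
    linarith
  constructor
  · obtain ⟨hA, hw, hv, hE⟩ := energy_jacobiSn_sq hksq ω C₂
    rw [hX]
    refine isTheSolution_moebius hx₀ _ _ _ _ hA hw hv hE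
      (fun t => (hden _ (sq_nonneg _)).ne') hdet.ne' (fun y hy => ?_) ?_ ?_
    · set D := (r₂ - r₁) * y + (r₄ - r₂) with hD
      set N := r₄ * (r₂ - r₁) * y + r₁ * (r₄ - r₂) with hN
      have hclear : (quartic ρ x₀ y₀ z₀).eval (N / D) * D ^ 4
          = -((N - r₁ * D) * (N - r₂ * D) * (N - r₃ * D) * (N - r₄ * D)) / 4 := by
        rw [hP]
        field_simp
      have e1 : N - r₁ * D = (r₄ - r₁) * (r₂ - r₁) * y := by rw [hN, hD]; ring
      have e2 : N - r₂ * D = -((r₄ - r₂) * (r₂ - r₁) * (1 - y)) := by rw [hN, hD]; ring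
      have e3 : N - r₃ * D = -((r₄ - r₂) * (r₃ - r₁) * (1 - k ^ 2 * y)) := by
        rw [hN, hD]
        linear_combination (-y) * hk2
      have e4 : N - r₄ * D = -((r₄ - r₁) * (r₄ - r₂)) := by rw [hN, hD]; ring
      rw [hclear, e1, e2, e3, e4]
      rw [hω2]
      ring
    · simp only [mul_zero, zero_add]
      rw [hC₂, jacobiSn_jacobiArcsn hksq (by linarith [Real.sqrt_nonneg a₀]) ha1,
        Real.sq_sqrt ha0, div_eq_iff (hden a₀ ha0).ne', ha₀]
      field_simp
      ring
    · have hcn := jacobiCn_jacobiArcsn_nonneg hksq (√a₀)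
      have hsn := jacobiSn_jacobiArcsn hksq (by linarith [Real.sqrt_nonneg a₀]) ha1
      have hdn := jacobiDn_pos hksq C₂
      simp only [mul_zero, zero_add]
      rw [← hC₂] at hcn hsn
      rw [hsn]
      have := Real.sqrt_nonneg a₀
      positivity
  · have hω' : 8 * ellipticK k / √((r₄ - r₂) * (r₃ - r₁)) = 2 * ellipticK k / ω := by
      rw [hω]
      field_simp
      ring
    obtain ⟨hm, hs, hT, hsq⟩ := two_mul_jacobiAm_affine hksq hω0 C₂
    have h := period_range_moebius_cos hm hs hT (a := -(r₄ * (r₂ - r₁)) / 2)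
      (b := r₄ * (r₂ - r₁) / 2 + r₁ * (r₄ - r₂)) (m := -(r₂ - r₁) / 2)
      (n := (r₂ - r₁) / 2 + (r₄ - r₂)) c
      (fun y hy => by nlinarith [hy.2]) (by linarith)
    have hX' : solSnLow c r₁ r₂ r₃ r₄ = fun t => (-(r₄ * (r₂ - r₁)) / 2
        * Real.cos (2 * jacobiAm (ω * t + C₂) k) + (r₄ * (r₂ - r₁) / 2 + r₁ * (r₄ - r₂)))
        / (-(r₂ - r₁) / 2 * Real.cos (2 * jacobiAm (ω * t + C₂) k)
          + ((r₂ - r₁) / 2 + (r₄ - r₂))) - c := by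
      rw [hX]
      funext t
      rw [hsq]
      congr 2 <;> ring
    rw [hX', hω']
    refine ⟨h.1, h.2.trans ?_⟩
    congr 2
    · rw [div_eq_iff (by linarith)]
      ring
    · rw [div_eq_iff (by linarith)]
      ring

/-- Four real roots, the motion taking place between the two largest ones. -/
lemma solSnHigh_spec {r₁ r₂ r₃ r₄ k : ℝ} (hx₀ : 0 ≤ x₀) (h₁₂ : r₁ < r₂) (h₂₃ : r₂ < r₃)
    (h₃₄ : r₃ < r₄)
    (hP : ∀ η, (quartic ρ x₀ y₀ z₀).eval η
      = -((η - r₁) * (η - r₂) * (η - r₃) * (η - r₄)) / 4)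
    (hk : k = modulusSn r₁ r₂ r₃ r₄) (hc₃ : r₃ ≤ z₀ + ρ) (hc₄ : z₀ + ρ ≤ r₄) :
    IsTheSolution ρ x₀ y₀ z₀ (solSnHigh (z₀ + ρ) r₁ r₂ r₃ r₄) ∧
      HasPeriod (solSnHigh (z₀ + ρ) r₁ r₂ r₃ r₄)
        (8 * ellipticK k / √((r₄ - r₂) * (r₃ - r₁))) ∧
      range (solSnHigh (z₀ + ρ) r₁ r₂ r₃ r₄) = Icc (r₃ - (z₀ + ρ)) (r₄ - (z₀ + ρ)) := by
  obtain ⟨hk2, hk0, hk1⟩ := modulusSn_sq h₁₂ h₂₃ h₃₄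
  set c := z₀ + ρ with hc
  rw [← hk] at hk2 hk0 hk1
  have hksq : k ^ 2 < 1 := by nlinarith
  have h43 : 0 < r₄ - r₃ := by linarith
  have h42 : 0 < r₄ - r₂ := by linarith
  have h31 : 0 < r₃ - r₁ := by linarith
  have h41 : 0 < r₄ - r₁ := by linarith
  have hc1 : 0 < c - r₁ := by linarith
  set a₀ := (r₃ - r₁) * (r₄ - c) / ((r₄ - r₃) * (c - r₁)) with ha₀
  have ha0 : 0 ≤ a₀ := div_nonneg (mul_nonneg h31.le (by linarith)) (by positivity)
  have ha1 : √a₀ ≤ 1 := by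
    rw [Real.sqrt_le_one, ha₀, div_le_one (by positivity)]
    have := mul_nonneg (sub_nonneg.2 hc₃) h41.le
    linarith
  set C₃ := jacobiArcsn (√a₀) k with hC₃
  set ω := √((r₄ - r₂) * (r₃ - r₁)) / 4 with hω
  have hω0 : 0 < ω := by positivity
  have hω2 : ω ^ 2 = (r₄ - r₂) * (r₃ - r₁) / 16 := by
    rw [hω, div_pow, Real.sq_sqrt (by positivity)]
    norm_num
  have hden : ∀ y, 0 ≤ y → 0 < (r₄ - r₃) * y + (r₃ - r₁) := fun y hy => by positivity
  have hX : solSnHigh c r₁ r₂ r₃ r₄ = fun t =>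
      (r₁ * (r₄ - r₃) * jacobiSn (ω * t + -C₃) k ^ 2 + r₄ * (r₃ - r₁))
        / ((r₄ - r₃) * jacobiSn (ω * t + -C₃) k ^ 2 + (r₃ - r₁)) - c := funext fun t => by
    simp only [solSnHigh, ← hk, ← ha₀, ← hC₃, ← hω, sub_eq_add_neg (ω * t)]
    set u := jacobiSn (ω * t + -C₃) k
    have := hden (u ^ 2) (sq_nonneg u)
    have h1 : 1 + (r₄ - r₃) / (r₃ - r₁) * u ^ 2
        = ((r₄ - r₃) * u ^ 2 + (r₃ - r₁)) / (r₃ - r₁) := by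
      field_simp
      ring
    rw [h1]
    field_simp
    ring
  have hdet : r₁ * (r₄ - r₃) * (r₃ - r₁) - r₄ * (r₃ - r₁) * (r₄ - r₃) < 0 := by
    have := mul_pos (mul_pos h41 h43) h31
    linarith
  constructor
  · obtain ⟨hA, hw, hv, hE⟩ := energy_jacobiSn_sq hksq ω (-C₃)
    rw [hX]
    refine isTheSolution_moebius hx₀ _ _ _ _ hA hw hv hE
      (fun t => (hden _ (sq_nonneg _)).ne') hdet.ne (fun y hy => ?_) ?_ ?_
    · set D := (r₄ - r₃) * y + (r₃ - r₁) with hD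
      set N := r₁ * (r₄ - r₃) * y + r₄ * (r₃ - r₁) with hN
      have hclear : (quartic ρ x₀ y₀ z₀).eval (N / D) * D ^ 4
          = -((N - r₁ * D) * (N - r₂ * D) * (N - r₃ * D) * (N - r₄ * D)) / 4 := by
        rw [hP]
        field_simp
      have e1 : N - r₁ * D = (r₄ - r₁) * (r₃ - r₁) := by rw [hN, hD]; ring
      have e2 : N - r₂ * D = (r₄ - r₂) * (r₃ - r₁) * (1 - k ^ 2 * y) := by
        rw [hN, hD]
        linear_combination y * hk2
      have e3 : N - r₃ * D = (r₄ - r₃) * (r₃ - r₁) * (1 - y) := by rw [hN, hD]; ring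
      have e4 : N - r₄ * D = -((r₄ - r₁) * (r₄ - r₃) * y) := by rw [hN, hD]; ring
      rw [hclear, e1, e2, e3, e4]
      rw [hω2]
      ring
    · simp only [mul_zero, zero_add]
      rw [jacobiSn_neg hksq, neg_sq, hC₃,
        jacobiSn_jacobiArcsn hksq (by linarith [Real.sqrt_nonneg a₀]) ha1,
        Real.sq_sqrt ha0, div_eq_iff (hden a₀ ha0).ne', ha₀]
      field_simp
      ring
    · have hcn := jacobiCn_jacobiArcsn_nonneg hksq (√a₀)
      have hsn := jacobiSn_jacobiArcsn hksq (by linarith [Real.sqrt_nonneg a₀]) ha1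
      have hdn := jacobiDn_pos hksq (-C₃)
      simp only [mul_zero, zero_add]
      rw [← hC₃] at hcn hsn
      rw [jacobiSn_neg hksq, jacobiCn_neg hksq, hsn]
      have := Real.sqrt_nonneg a₀
      have h := mul_nonneg (neg_nonneg.2 hdet.le)
        (by positivity : 0 ≤ 2 * ω * (√a₀ * jacobiCn C₃ k * jacobiDn (-C₃) k))
      refine h.trans_eq ?_
      ring
  · have hω' : 8 * ellipticK k / √((r₄ - r₂) * (r₃ - r₁)) = 2 * ellipticK k / ω := by
      rw [hω]
      field_simp
      ring
    obtain ⟨hm, hs, hT, hsq⟩ := two_mul_jacobiAm_affine hksq hω0 (-C₃)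
    have h := period_range_moebius_cos' hm hs hT (a := -(r₁ * (r₄ - r₃)) / 2)
      (b := r₁ * (r₄ - r₃) / 2 + r₄ * (r₃ - r₁)) (m := -(r₄ - r₃) / 2)
      (n := (r₄ - r₃) / 2 + (r₃ - r₁)) c
      (fun y hy => by nlinarith [hy.2]) (by linarith)
    have hX' : solSnHigh c r₁ r₂ r₃ r₄ = fun t => (-(r₁ * (r₄ - r₃)) / 2
        * Real.cos (2 * jacobiAm (ω * t + -C₃) k) + (r₁ * (r₄ - r₃) / 2 + r₄ * (r₃ - r₁)))
        / (-(r₄ - r₃) / 2 * Real.cos (2 * jacobiAm (ω * t + -C₃) k)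
          + ((r₄ - r₃) / 2 + (r₃ - r₁))) - c := by
      rw [hX]
      funext t
      rw [hsq]
      congr 2 <;> ring
    rw [hX', hω']
    refine ⟨h.1, h.2.trans ?_⟩
    congr 2
    · rw [div_eq_iff (by linarith)]
      ring
    · rw [div_eq_iff (by linarith)]
      ring

end

/-! ### Multiple roots: elementary functions -/

section

variable {ρ x₀ y₀ z₀ : ℝ}

/-- A function `N / (B + S w) + r - c` for which `w` has image `[1, ∞)` and takes the value `1`
only once is not periodic, and its image is a half-open interval ending at `r - c`. -/
lemma notPeriodic_range_of_unbounded {w : ℝ → ℝ} {t₀ : ℝ} (hr : range w = Ici 1)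
    (h₀ : w t₀ = 1) (huniq : ∀ t, w t = 1 → t = t₀) {N B S : ℝ} (hN : N ≠ 0) (hS : 0 < S)
    (hBS : 0 < B + S) (r c : ℝ) :
    NotPeriodic (fun t => N / (B + S * w t) + r - c) ∧
      (0 < N → range (fun t => N / (B + S * w t) + r - c)
        = Ioc (r - c) (N / (B + S) + r - c)) ∧
      (N < 0 → range (fun t => N / (B + S * w t) + r - c)
        = Ico (N / (B + S) + r - c) (r - c)) := by
  have hw : ∀ t, 1 ≤ w t := fun t => by
    have : w t ∈ range w := mem_range_self t
    rwa [hr] at this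
  have hpos : ∀ y, 1 ≤ y → B + S ≤ B + S * y := fun y hy => by nlinarith
  have hsurj : ∀ y, 1 ≤ y → ∃ t, w t = y := fun y hy => by
    have : y ∈ range w := by rw [hr]; exact hy
    exact this
  refine ⟨fun T hT hp => hT ?_, fun hN0 => ?_, fun hN0 => ?_⟩
  · have h := hp t₀
    simp only [h₀, mul_one] at h
    have h1 : N / (B + S * w (t₀ + T)) = N / (B + S) := by linarith
    have h2 := hpos _ (hw (t₀ + T))
    rw [div_eq_div_iff (by linarith) hBS.ne'] at h1
    have h3 := mul_left_cancel₀ hN h1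
    have h4 : w (t₀ + T) = 1 := by
      refine mul_left_cancel₀ hS.ne' ?_
      linarith
    have := huniq _ h4
    linarith
  · ext y
    constructor
    · rintro ⟨t, rfl⟩
      have h := hpos _ (hw t)
      have h1 : 0 < N / (B + S * w t) := div_pos hN0 (by linarith)
      have h2 : N / (B + S * w t) ≤ N / (B + S) := div_le_div_of_nonneg_left hN0.le hBS h
      exact ⟨by simp only; linarith, by simp only; linarith⟩
    · rintro ⟨h1, h2⟩
      have hd : 0 < y - r + c := by linarith
      have hle : B + S ≤ N / (y - r + c) := by
        rw [le_div_iff₀ hd, ← le_div_iff₀' hBS]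
        linarith
      obtain ⟨t, ht⟩ := hsurj ((N / (y - r + c) - B) / S) (by
        rw [le_div_iff₀ hS]
        linarith)
      refine ⟨t, ?_⟩
      simp only
      rw [ht, mul_div_cancel₀ _ hS.ne', add_sub_cancel, div_div_cancel₀ hN]
      ring
  · ext y
    constructor
    · rintro ⟨t, rfl⟩
      have h := hpos _ (hw t)
      have h1 : N / (B + S * w t) < 0 := div_neg_of_neg_of_pos hN0 (by linarith)
      have h2 : -N / (B + S * w t) ≤ -N / (B + S) :=
        div_le_div_of_nonneg_left (by linarith) hBS h
      rw [neg_div, neg_div] at h2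
      exact ⟨by simp only; linarith, by simp only; linarith⟩
    · rintro ⟨h1, h2⟩
      have hd : y - r + c < 0 := by linarith
      have hle : B + S ≤ N / (y - r + c) := by
        rw [le_div_iff_of_neg hd, ← div_le_iff₀' hBS]
        linarith
      obtain ⟨t, ht⟩ := hsurj ((N / (y - r + c) - B) / S) (by
        rw [le_div_iff₀ hS]
        linarith)
      refine ⟨t, ?_⟩
      simp only
      rw [ht, mul_div_cancel₀ _ hS.ne', add_sub_cancel, div_div_cancel₀ hN]
      ring

lemma range_cosh_affine {a : ℝ} (ha : a ≠ 0) (C : ℝ) :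
    range (fun t => Real.cosh (a * t + C)) = Ici 1 ∧ Real.cosh (a * (-C / a) + C) = 1 ∧
      ∀ t, Real.cosh (a * t + C) = 1 → t = -C / a := by
  refine ⟨Subset.antisymm ?_ ?_, ?_, fun t ht => ?_⟩
  · rintro _ ⟨t, rfl⟩
    exact Real.one_le_cosh _
  · intro y hy
    refine ⟨(Real.arcosh y - C) / a, ?_⟩
    simp only
    rw [mul_div_cancel₀ _ ha, sub_add_cancel, Real.cosh_arcosh hy]
  · rw [mul_div_cancel₀ _ ha, neg_add_cancel, Real.cosh_zero]
  · have h : a * t + C = 0 := by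
      by_contra hne
      exact (Real.one_lt_cosh.2 hne).ne' ht
    rw [eq_div_iff ha]
    linarith

/-- A double root `r`, with the other roots `-r ± 2 s`, where `r² - s² = μ`: every function `w` with
`w'' = -μ w` and `w' ^ 2 = μ (1 - w²)`, a cosine or a hyperbolic cosine, gives a solution. -/
lemma isTheSolution_doubleRoot {r s μ : ℝ} (hx₀ : 0 ≤ x₀) (hμ : μ = r ^ 2 - s ^ 2) (hμ0 : μ ≠ 0)
    (hs : s ≠ 0)
    (hP : ∀ η, (quartic ρ x₀ y₀ z₀).eval η = -((η - r) ^ 2 * ((η + r) ^ 2 - 4 * s ^ 2)) / 4)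
    {w v : ℝ → ℝ} (hw : ∀ t, HasDerivAt w (v t) t) (hv : ∀ t, HasDerivAt v (-μ * w t) t)
    (hE : ∀ t, v t ^ 2 = μ * (1 - w t ^ 2)) (hne : ∀ t, r + s * w t ≠ 0)
    (hc : z₀ + ρ ≠ r) (h0 : s * w 0 = -(2 * μ) / (z₀ + ρ - r) - r) (hsgn : 0 ≤ μ * s * v 0) :
    IsTheSolution ρ x₀ y₀ z₀ (fun t => -(2 * μ) / (r + s * w t) + r - (z₀ + ρ)) := by
  have hX : (fun t => -(2 * μ) / (r + s * w t) + r - (z₀ + ρ))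
      = fun t => (r * s * w t + (r ^ 2 - 2 * μ)) / (s * w t + r) - (z₀ + ρ) := funext fun t => by
    have h1 := hne t
    have h2 : s * w t + r ≠ 0 := by rwa [add_comm]
    rw [add_comm r (s * w t)]
    field_simp
    ring
  have hcr : z₀ + ρ - r ≠ 0 := sub_ne_zero.2 hc
  have hdet : r * s * r - (r ^ 2 - 2 * μ) * s = 2 * (μ * s) := by ring
  rw [hX]
  refine isTheSolution_moebius hx₀ (A := fun y => μ * (1 - y ^ 2)) (A₁ := fun y => -(2 * μ) * y)
    _ _ _ _ (fun y => ?_) hw (fun t => (hv t).congr_deriv (by ring)) hE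
    (fun t => by rw [add_comm]; exact hne t) ?_ (fun y hy => ?_) ?_ ?_
  · refine ((((hasDerivAt_id y).pow 2).const_sub 1).const_mul μ).congr_deriv ?_
    simp only [id]
    push_cast
    ring
  · rw [hdet]
    exact mul_ne_zero two_ne_zero (mul_ne_zero hμ0 hs)
  · set D := s * y + r with hD
    set N := r * s * y + (r ^ 2 - 2 * μ) with hN
    have hclear : (quartic ρ x₀ y₀ z₀).eval (N / D) * D ^ 4
        = -((N - r * D) ^ 2 * ((N + r * D - 2 * s * D) * (N + r * D + 2 * s * D))) / 4 := by
      rw [hP]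
      field_simp
      ring
    have e1 : N - r * D = -(2 * μ) := by rw [hN, hD]; ring
    have e2 : N + r * D - 2 * s * D = -(2 * s * (r - s) * (1 - y)) := by
      rw [hN, hD, hμ]; ring
    have e3 : N + r * D + 2 * s * D = 2 * s * (r + s) * (1 + y) := by rw [hN, hD, hμ]; ring
    rw [hclear, hdet, e1, e2, e3]
    linear_combination 4 * μ ^ 2 * s ^ 2 * (1 - y ^ 2) * hμ
  · have h1 : s * w 0 + r = -(2 * μ) / (z₀ + ρ - r) := by rw [h0]; ring
    rw [div_eq_iff (by rw [add_comm]; exact hne 0)]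
    have h2 : (s * w 0 + r) * (z₀ + ρ - r) = -(2 * μ) := by
      rw [h1, div_mul_cancel₀ _ hcr]
    linear_combination -h2
  · rw [hdet]
    linarith

section DoubleRoot

variable {r s μ : ℝ}

lemma initial_le_of_double_root
    (hP : ∀ η, (quartic ρ x₀ y₀ z₀).eval η = -((η - r) ^ 2 * ((η + r) ^ 2 - 4 * s ^ 2)) / 4)
    (hc : z₀ + ρ ≠ r) : (z₀ + ρ + r) ^ 2 ≤ 4 * s ^ 2 := by
  have h := quartic_eval_initial ρ x₀ y₀ z₀
  rw [hP] at h
  have hpos : 0 < (z₀ + ρ - r) ^ 2 := by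
    have := sub_ne_zero.2 hc
    positivity
  by_contra! hlt
  have := mul_pos hpos (sub_pos.2 hlt)
  have := sq_nonneg x₀
  linarith

/-- A double root outside the interval of motion. -/
lemma solCos_spec (hx₀ : 0 ≤ x₀) (hs : 0 < s) (hμ : μ = r ^ 2 - s ^ 2) (hμ0 : 0 < μ)
    (hP : ∀ η, (quartic ρ x₀ y₀ z₀).eval η = -((η - r) ^ 2 * ((η + r) ^ 2 - 4 * s ^ 2)) / 4)
    (hc : z₀ + ρ ≠ r) :
    IsTheSolution ρ x₀ y₀ z₀ (solCos (z₀ + ρ) r μ) ∧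
      HasPeriod (solCos (z₀ + ρ) r μ) (2 * Real.pi / √μ) ∧
      range (solCos (z₀ + ρ) r μ)
        = Icc (-r - 2 * s - (z₀ + ρ)) (-r + 2 * s - (z₀ + ρ)) := by
  have hc2 := initial_le_of_double_root hP hc
  set c := z₀ + ρ with hcdef
  have hsqrt : √(r ^ 2 - μ) = s := by
    rw [hμ, sub_sub_cancel, Real.sqrt_sq hs.le]
  have hcr : c - r ≠ 0 := sub_ne_zero.2 hc
  set w₀ := 1 / s * (-(2 * μ) / (c - r) - r) with hw₀
  have hsw : s * w₀ = -(2 * μ) / (c - r) - r := by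
    rw [hw₀]
    field_simp
  have hw1 : w₀ ^ 2 ≤ 1 := by
    have h1 : (1 - w₀ ^ 2) * (s ^ 2 * (c - r) ^ 2) = μ * (4 * s ^ 2 - (c + r) ^ 2) := by
      have h2 : s * w₀ * (c - r) = -(2 * μ) - r * (c - r) := by
        rw [hsw]
        field_simp
      have h3 : (s * w₀ * (c - r)) ^ 2 = (-(2 * μ) - r * (c - r)) ^ 2 := by rw [h2]
      linear_combination -h3 + ((c - r) ^ 2 - 4 * μ) * hμ
    have h2 : 0 ≤ μ * (4 * s ^ 2 - (c + r) ^ 2) := mul_nonneg hμ0.le (by linarith)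
    have h3 : 0 < s ^ 2 * (c - r) ^ 2 := by positivity
    by_contra! hlt
    have := mul_pos (sub_pos.2 hlt) h3
    linarith
  obtain ⟨hwl, hwu⟩ := abs_le.1 ((sq_le_one_iff_abs_le_one w₀).1 hw1)
  set C₄ := Real.arccos w₀ with hC₄
  have hX : solCos c r μ = fun t => -(2 * μ) / (r + s * Real.cos (√μ * t + -C₄)) + r - c :=
    funext fun t => by simp only [solCos, hsqrt, ← hw₀, ← hC₄, sub_eq_add_neg (√μ * t)]
  have hμ2 : √μ ^ 2 = μ := Real.sq_sqrt hμ0.le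
  have hμs : 0 < √μ := Real.sqrt_pos.2 hμ0
  have habs : s < |r| := by
    refine lt_of_pow_lt_pow_left₀ 2 (abs_nonneg r) ?_
    rw [sq_abs]
    linarith
  -- the denominator has the constant sign of `r`
  have hden : (∀ y ∈ Icc (-1 : ℝ) 1, 0 < s * y + r) ∨ ∀ y ∈ Icc (-1 : ℝ) 1, 0 < -s * y + -r := by
    rcases le_or_gt 0 r with h | h
    · rw [abs_of_nonneg h] at habs
      exact Or.inl fun y hy => by nlinarith [hy.1]
    · rw [abs_of_neg h] at habs
      exact Or.inr fun y hy => by nlinarith [hy.2]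
  have hne : ∀ y ∈ Icc (-1 : ℝ) 1, r + s * y ≠ 0 := fun y hy => by
    rcases hden with h | h
    · have := h y hy
      intro h0
      linarith
    · have := h y hy
      intro h0
      linarith
  constructor
  · rw [hX]
    refine isTheSolution_doubleRoot hx₀ hμ hμ0.ne' hs.ne' hP
      (v := fun t => √μ * -Real.sin (√μ * t + -C₄))
      (fun t => hasDerivAt_comp_affine (Real.hasDerivAt_cos _)) (fun t => ?_) (fun t => ?_)
      (fun t => hne _ (Real.cos_mem_Icc _)) hc ?_ ?_
    · refine ((hasDerivAt_comp_affine (Real.hasDerivAt_sin _).neg).const_mul (√μ)).congr_deriv ?_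
      linear_combination -Real.cos (√μ * t + -C₄) * hμ2
    · rw [mul_pow, hμ2, neg_sq, Real.sin_sq]
    · rw [mul_zero, zero_add, Real.cos_neg, hC₄, Real.cos_arccos hwl hwu, hsw]
    · rw [mul_zero, zero_add, Real.sin_neg, neg_neg]
      have : 0 ≤ Real.sin C₄ :=
        Real.sin_nonneg_of_nonneg_of_le_pi (Real.arccos_nonneg _) (Real.arccos_le_pi _)
      positivity
  · have hm : StrictMono fun t => √μ * t + -C₄ := fun a b hab => by
      have := mul_lt_mul_of_pos_left hab hμs
      linarith
    have hsur : Function.Surjective fun t => √μ * t + -C₄ := fun φ => ⟨(φ + C₄) / √μ, by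
      simp only
      rw [mul_div_cancel₀ _ hμs.ne']
      ring⟩
    have hT : ∀ t, √μ * (t + 2 * Real.pi / √μ) + -C₄ = √μ * t + -C₄ + 2 * Real.pi := fun t => by
      field_simp
      ring
    have hval : (-(r * s) + (r ^ 2 - 2 * μ)) / (-s + r) = -r - 2 * s ∧
        (r * s + (r ^ 2 - 2 * μ)) / (s + r) = -r + 2 * s := by
      have h1 := hne (-1) ⟨by norm_num, by norm_num⟩
      have h2 := hne 1 ⟨by norm_num, by norm_num⟩
      constructor
      · rw [div_eq_iff (by intro h; apply h1; linarith), hμ]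
        ring
      · rw [div_eq_iff (by intro h; apply h2; linarith), hμ]
        ring
    have hμs2 : 0 < μ * s := mul_pos hμ0 hs
    rcases hden with hden | hden
    · have h := period_range_moebius_cos' hm hsur hT (a := r * s) (b := r ^ 2 - 2 * μ) c hden
        (by linarith)
      have hX' : solCos c r μ = fun t => (r * s * Real.cos (√μ * t + -C₄) + (r ^ 2 - 2 * μ))
          / (s * Real.cos (√μ * t + -C₄) + r) - c := by
        rw [hX]
        funext t
        have := (hden _ (Real.cos_mem_Icc (√μ * t + -C₄))).ne'
        rw [add_comm r (s * _)]
        field_simp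
        ring
      rw [hX']
      refine ⟨h.1, h.2.trans ?_⟩
      rw [hval.1, hval.2]
    · have h := period_range_moebius_cos' hm hsur hT (a := -(r * s)) (b := -(r ^ 2 - 2 * μ)) c hden
        (by linarith)
      have hX' : solCos c r μ = fun t => (-(r * s) * Real.cos (√μ * t + -C₄) + -(r ^ 2 - 2 * μ))
          / (-s * Real.cos (√μ * t + -C₄) + -r) - c := by
        rw [hX]
        funext t
        have h1 := (hden _ (Real.cos_mem_Icc (√μ * t + -C₄))).ne'
        have h2 : s * Real.cos (√μ * t + -C₄) + r ≠ 0 := fun h => h1 (by linarith)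
        rw [add_comm r (s * _), show -(r * s) * Real.cos (√μ * t + -C₄) + -(r ^ 2 - 2 * μ)
          = -(r * s * Real.cos (√μ * t + -C₄) + (r ^ 2 - 2 * μ)) by ring,
          show -s * Real.cos (√μ * t + -C₄) + -r = -(s * Real.cos (√μ * t + -C₄) + r) by ring,
          neg_div_neg_eq]
        field_simp
        ring
      rw [hX']
      refine ⟨h.1, h.2.trans ?_⟩
      rw [← hval.1, ← hval.2, ← neg_div_neg_eq (- -(r * s) + _), ← neg_div_neg_eq (-(r * s) + -_)]
      congr 3 <;> ring

/-- A double root between the two simple ones, the motion taking place to its right. -/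
lemma solCoshRight_spec (hx₀ : 0 ≤ x₀) (hs : 0 < s) (hμ : μ = r ^ 2 - s ^ 2) (hμ0 : μ < 0)
    (hP : ∀ η, (quartic ρ x₀ y₀ z₀).eval η = -((η - r) ^ 2 * ((η + r) ^ 2 - 4 * s ^ 2)) / 4)
    (hc : r < z₀ + ρ) :
    IsTheSolution ρ x₀ y₀ z₀ (solCoshRight (z₀ + ρ) r μ) ∧
      NotPeriodic (solCoshRight (z₀ + ρ) r μ) ∧
      range (solCoshRight (z₀ + ρ) r μ) = Ioc (r - (z₀ + ρ)) (-r + 2 * s - (z₀ + ρ)) := by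
  have hc2 := initial_le_of_double_root hP hc.ne'
  set c := z₀ + ρ with hcdef
  have hsqrt : √(r ^ 2 - μ) = s := by
    rw [hμ, sub_sub_cancel, Real.sqrt_sq hs.le]
  have hcr : 0 < c - r := sub_pos.2 hc
  obtain ⟨hrl, hru⟩ := abs_lt_of_sq_lt_sq' (show r ^ 2 < s ^ 2 by linarith) hs.le
  have hcs : c + r ≤ 2 * s := abs_le_of_sq_le_sq' (by linarith : (c + r) ^ 2 ≤ (2 * s) ^ 2)
    (by linarith) |>.2
  set w₀ := 1 / s * (-(2 * μ) / (c - r) - r) with hw₀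
  have hsw : s * w₀ = -(2 * μ) / (c - r) - r := by
    rw [hw₀]
    field_simp
  have hw1 : 1 ≤ w₀ := by
    have h1 : s + r ≤ -(2 * μ) / (c - r) := by
      rw [le_div_iff₀ hcr, hμ]
      nlinarith [mul_nonneg (by linarith : 0 ≤ s + r) (by linarith : 0 ≤ 2 * s - (c + r))]
    refine le_of_mul_le_mul_left ?_ hs
    linarith
  set C₅ := -Real.arcosh w₀ with hC₅
  have hX : solCoshRight c r μ
      = fun t => -(2 * μ) / (r + s * Real.cosh (√(-μ) * t + C₅)) + r - c :=
    funext fun t => by simp only [solCoshRight, hsqrt, ← hw₀, ← hC₅]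
  have hμ2 : √(-μ) ^ 2 = -μ := Real.sq_sqrt (by linarith)
  have hμs : 0 < √(-μ) := Real.sqrt_pos.2 (by linarith)
  rw [hX]
  constructor
  · refine isTheSolution_doubleRoot hx₀ hμ hμ0.ne hs.ne' hP
      (v := fun t => √(-μ) * Real.sinh (√(-μ) * t + C₅))
      (fun t => hasDerivAt_comp_affine (Real.hasDerivAt_cosh _)) (fun t => ?_) (fun t => ?_)
      (fun t => ?_) hc.ne' ?_ ?_
    · refine ((hasDerivAt_comp_affine (Real.hasDerivAt_sinh _)).const_mul _).congr_deriv ?_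
      linear_combination Real.cosh (√(-μ) * t + C₅) * hμ2
    · rw [mul_pow, hμ2, Real.sinh_sq]
      ring
    · have := mul_le_mul_of_nonneg_left (Real.one_le_cosh (√(-μ) * t + C₅)) hs.le
      intro h0
      linarith
    · rw [mul_zero, zero_add, hC₅, Real.cosh_neg, Real.cosh_arcosh hw1, hsw]
    · rw [mul_zero, zero_add, hC₅, Real.sinh_neg]
      have h1 : 0 ≤ Real.sinh (Real.arcosh w₀) := Real.sinh_nonneg_iff.2 (Real.arcosh_nonneg hw1)
      have h2 : 0 ≤ -μ := by linarith
      have : 0 ≤ -μ * s * (√(-μ) * Real.sinh (Real.arcosh w₀)) := by positivity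
      linarith
  · obtain ⟨hr, h0, hu⟩ := range_cosh_affine hμs.ne' C₅
    obtain ⟨h1, h2, -⟩ := notPeriodic_range_of_unbounded hr h0 hu
      (show -(2 * μ) ≠ 0 by linarith) hs (show 0 < r + s by linarith) r c
    refine ⟨h1, (h2 (by linarith)).trans ?_⟩
    congr 2
    have : r + s ≠ 0 := by linarith
    rw [hμ]
    field_simp
    ring

/-- A double root between the two simple ones, the motion taking place to its left. -/
lemma solCoshLeft_spec (hx₀ : 0 ≤ x₀) (hs : 0 < s) (hμ : μ = r ^ 2 - s ^ 2) (hμ0 : μ < 0)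
    (hP : ∀ η, (quartic ρ x₀ y₀ z₀).eval η = -((η - r) ^ 2 * ((η + r) ^ 2 - 4 * s ^ 2)) / 4)
    (hc : z₀ + ρ < r) :
    IsTheSolution ρ x₀ y₀ z₀ (solCoshLeft (z₀ + ρ) r μ) ∧
      NotPeriodic (solCoshLeft (z₀ + ρ) r μ) ∧
      range (solCoshLeft (z₀ + ρ) r μ) = Ico (-r - 2 * s - (z₀ + ρ)) (r - (z₀ + ρ)) := by
  have hc2 := initial_le_of_double_root hP hc.ne
  set c := z₀ + ρ with hcdef
  have hsqrt : √(r ^ 2 - μ) = s := by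
    rw [hμ, sub_sub_cancel, Real.sqrt_sq hs.le]
  have hcr : c - r < 0 := sub_neg.2 hc
  obtain ⟨hrl, hru⟩ := abs_lt_of_sq_lt_sq' (show r ^ 2 < s ^ 2 by linarith) hs.le
  have hcs : -(2 * s) ≤ c + r := abs_le_of_sq_le_sq' (by linarith : (c + r) ^ 2 ≤ (2 * s) ^ 2)
    (by linarith) |>.1
  set w₀ := 1 / s * (2 * μ / (c - r) + r) with hw₀
  have hsw : s * w₀ = 2 * μ / (c - r) + r := by
    rw [hw₀]
    field_simp
  have hw1 : 1 ≤ w₀ := by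
    have h1 : s - r ≤ 2 * μ / (c - r) := by
      rw [le_div_iff_of_neg hcr, hμ]
      nlinarith [mul_nonneg (by linarith : 0 ≤ s - r) (by linarith : 0 ≤ 2 * s + (c + r))]
    refine le_of_mul_le_mul_left ?_ hs
    linarith
  set C₆ := Real.arcosh w₀ with hC₆
  have hX : solCoshLeft c r μ
      = fun t => -(2 * μ) / (r + -s * Real.cosh (√(-μ) * t + C₆)) + r - c :=
    funext fun t => by
      simp only [solCoshLeft, hsqrt, ← hw₀, ← hC₆, sub_eq_add_neg r, neg_mul]
  have hμ2 : √(-μ) ^ 2 = -μ := Real.sq_sqrt (by linarith)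
  have hμs : 0 < √(-μ) := Real.sqrt_pos.2 (by linarith)
  constructor
  · rw [hX]
    refine isTheSolution_doubleRoot hx₀ (s := -s) (by rw [neg_sq, hμ]) hμ0.ne
      (neg_ne_zero.2 hs.ne') (by simpa only [neg_sq] using hP)
      (v := fun t => √(-μ) * Real.sinh (√(-μ) * t + C₆))
      (fun t => hasDerivAt_comp_affine (Real.hasDerivAt_cosh _)) (fun t => ?_) (fun t => ?_)
      (fun t => ?_) hc.ne ?_ ?_
    · refine ((hasDerivAt_comp_affine (Real.hasDerivAt_sinh _)).const_mul _).congr_deriv ?_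
      linear_combination Real.cosh (√(-μ) * t + C₆) * hμ2
    · rw [mul_pow, hμ2, Real.sinh_sq]
      ring
    · have := mul_le_mul_of_nonneg_left (Real.one_le_cosh (√(-μ) * t + C₆)) hs.le
      intro h0
      linarith
    · rw [mul_zero, zero_add, hC₆, Real.cosh_arcosh hw1, neg_mul, hsw, ← hcdef]
      ring
    · rw [mul_zero, zero_add]
      have h1 : 0 ≤ Real.sinh C₆ := Real.sinh_nonneg_iff.2 (Real.arcosh_nonneg hw1)
      have h2 : 0 ≤ -μ := by linarith
      have : 0 ≤ -μ * s * (√(-μ) * Real.sinh C₆) := by positivity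
      linarith
  · obtain ⟨hr, h0, hu⟩ := range_cosh_affine hμs.ne' C₆
    obtain ⟨h1, -, h2⟩ := notPeriodic_range_of_unbounded hr h0 hu
      (show 2 * μ ≠ 0 by linarith) hs (show 0 < -r + s by linarith) r c
    have hX' : solCoshLeft c r μ
        = fun t => 2 * μ / (-r + s * Real.cosh (√(-μ) * t + C₆)) + r - c := by
      rw [hX]
      funext t
      rw [← neg_div_neg_eq]
      congr 3 <;> ring
    rw [hX']
    refine ⟨h1, (h2 (by linarith)).trans ?_⟩
    congr 2
    have : -r + s ≠ 0 := by linarith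
    rw [hμ]
    field_simp
    ring

end DoubleRoot

/-- A triple root `r`, with the simple root `-3 r`. -/
lemma solRational_spec {r : ℝ} (hx₀ : 0 ≤ x₀) (hr : r ≠ 0)
    (hP : ∀ η, (quartic ρ x₀ y₀ z₀).eval η = -((η - r) ^ 3 * (η + 3 * r)) / 4)
    (hc : z₀ + ρ ≠ r) :
    IsTheSolution ρ x₀ y₀ z₀ (solRational (z₀ + ρ) r) ∧
      NotPeriodic (solRational (z₀ + ρ) r) ∧
      (r < 0 → range (solRational (z₀ + ρ) r) = Ioc (r - (z₀ + ρ)) (-(3 * r) - (z₀ + ρ))) ∧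
      (0 < r → range (solRational (z₀ + ρ) r) = Ico (-(3 * r) - (z₀ + ρ)) (r - (z₀ + ρ))) := by
  have hc2 := quartic_eval_initial ρ x₀ y₀ z₀
  rw [hP] at hc2
  set c := z₀ + ρ with hcdef
  have hcr : c - r ≠ 0 := sub_ne_zero.2 hc
  have hrc : r - c ≠ 0 := sub_ne_zero.2 hc.symm
  set a₀ := (3 * r + c) / (r - c) with ha₀
  have ha0 : 0 ≤ a₀ := by
    have h1 : a₀ * (r - c) ^ 4 = 4 * x₀ ^ 2 := by
      have : a₀ * (r - c) = 3 * r + c := div_mul_cancel₀ _ hrc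
      linear_combination (r - c) ^ 3 * this + 4 * hc2
    have h2 : 0 < (r - c) ^ 4 := by positivity
    by_contra! hlt
    have := mul_neg_of_neg_of_pos hlt h2
    have := sq_nonneg x₀
    linarith
  set C₇ := 1 / r * √a₀ with hC₇
  have hC2 : r ^ 2 * C₇ ^ 2 = a₀ := by
    rw [hC₇, mul_pow, Real.sq_sqrt ha0]
    field_simp
  set w : ℝ → ℝ := fun t => 1 + r ^ 2 * (t + C₇) ^ 2 with hw
  have hw0 : ∀ t, w t ≠ 0 := fun t => by
    have : 0 < w t := by positivity
    exact this.ne'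
  constructor
  · have hX : solRational c r = fun t => (r * w t + -(4 * r)) / (1 * w t + 0) - c :=
      funext fun t => by
        simp only [solRational, ← ha₀, ← hC₇]
        rw [one_mul, add_zero, add_div, mul_div_cancel_right₀ _ (hw0 t)]
        ring
    rw [hX]
    have hlin : ∀ t, HasDerivAt (fun t : ℝ => t + C₇) 1 t := fun t => (hasDerivAt_id t).add_const C₇
    refine isTheSolution_moebius hx₀ (v := fun t => 2 * r ^ 2 * (t + C₇))
      (A := fun y => 4 * r ^ 2 * (y - 1)) (A₁ := fun _ => 4 * r ^ 2) _ _ _ _ (fun y => ?_)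
      (fun t => ?_) (fun t => ?_) (fun t => ?_) (fun t => ?_) ?_ (fun y hy => ?_) ?_ ?_
    · simpa using ((hasDerivAt_id y).sub_const 1).const_mul (4 * r ^ 2)
    · refine ((((hlin t).pow 2).const_mul (r ^ 2)).const_add 1).congr_deriv ?_
      push_cast
      ring
    · refine ((hlin t).const_mul (2 * r ^ 2)).congr_deriv ?_
      ring
    · simp only [hw]
      ring
    · rw [one_mul, add_zero]
      exact hw0 t
    · simpa using hr
    · rw [one_mul, add_zero] at hy ⊢
      rw [hP]
      field_simp
      ring
    · have h1 : w 0 = -(4 * r) / (c - r) := by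
        simp only [hw, zero_add, hC2]
        rw [ha₀]
        field_simp
        ring
      rw [one_mul, add_zero, add_div, mul_div_cancel_right₀ _ (hw0 0), h1]
      field_simp
      ring
    · rw [zero_add]
      have h1 : r * C₇ = √a₀ := by
        rw [hC₇]
        field_simp
      have h2 : (r * 0 - -(4 * r) * 1) * (2 * r ^ 2 * C₇) = 8 * r ^ 2 * √a₀ := by
        rw [← h1]
        ring
      rw [h2]
      positivity
  · have hrange : range w = Ici 1 := by
      refine Subset.antisymm ?_ fun y hy => ⟨√(y - 1) / r - C₇, ?_⟩
      · rintro _ ⟨t, rfl⟩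
        have : 0 ≤ r ^ 2 * (t + C₇) ^ 2 := by positivity
        exact le_add_of_nonneg_right this
      · have hy' : 0 ≤ y - 1 := sub_nonneg.2 hy
        simp only [hw, sub_add_cancel, div_pow, Real.sq_sqrt hy']
        field_simp
        ring
    obtain ⟨h1, h2, h3⟩ := notPeriodic_range_of_unbounded (t₀ := -C₇) hrange (by simp [hw])
      (fun t ht => by
        have : r ^ 2 * (t + C₇) ^ 2 = 0 := by simpa [hw] using ht
        rcases mul_eq_zero.1 this with h | h
        · exact absurd h (pow_ne_zero 2 hr)
        · have := pow_eq_zero_iff two_ne_zero |>.1 h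
          linarith)
      (N := -(4 * r)) (B := 0) (S := 1) (by simpa using hr) one_pos (by norm_num) r c
    have hX : solRational c r = fun t => -(4 * r) / (0 + 1 * w t) + r - c := funext fun t => by
      simp only [solRational, ← ha₀, ← hC₇, hw, zero_add, one_mul]
    rw [hX]
    refine ⟨h1, fun h => (h2 (by linarith)).trans ?_, fun h => (h3 (by linarith)).trans ?_⟩
    · congr 2
      ring
    · congr 2
      ring

end

/-! ### Multiple roots in terms of the coefficients -/

lemma sq_add_three_mul_of_double_root {p q r : ℝ} (hq : q = r ^ 2 * (2 * p + 3 * r ^ 2)) :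
    p ^ 2 + 3 * q = (p + 3 * r ^ 2) ^ 2 := by
  rw [hq]
  ring

lemma rPar_of_double_root {ρ p q r : ℝ} (hρ : ρ = r * (p + r ^ 2) / 2)
    (hq : q = r ^ 2 * (2 * p + 3 * r ^ 2)) (h₁ : p + r ^ 2 ≠ 0) (h₃ : p + 3 * r ^ 2 ≠ 0) :
    rPar ρ p q = r := by
  have hd : p ^ 3 - p * q + 36 * ρ ^ 2 = (p + r ^ 2) * (p + 3 * r ^ 2) ^ 2 := by
    rw [hq, hρ]
    ring
  rw [rPar, hd, sq_add_three_mul_of_double_root hq,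
    div_eq_iff (mul_ne_zero h₁ (pow_ne_zero 2 h₃)), hρ]
  ring

lemma muPar_of_double_root {ρ p q r : ℝ} (hρ : ρ = r * (p + r ^ 2) / 2)
    (hq : q = r ^ 2 * (2 * p + 3 * r ^ 2)) (h₃ : p + 3 * r ^ 2 ≠ 0) :
    muPar ρ p q = (p + 3 * r ^ 2) / 2 := by
  have hn : 9 * ρ ^ 2 - p * q = r ^ 2 / 4 * (p + 3 * r ^ 2) ^ 2 := by
    rw [hq, hρ]
    ring
  rw [muPar, hn, sq_add_three_mul_of_double_root hq, mul_div_cancel_right₀ _ (pow_ne_zero 2 h₃)]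
  ring

/-- A multiple root of the quartic is not the initial value. -/
lemma initial_ne_of_double_root {ρ x₀ y₀ z₀ r : ℝ}
    (h : x₀ ^ 2 + (ρ - (y₀ + 1) * (z₀ + ρ)) ^ 2 ≠ 0)
    (hρ : ρ = r * (pZero ρ y₀ z₀ + r ^ 2) / 2)
    (hP : (quartic ρ x₀ y₀ z₀).eval r = 0) : z₀ + ρ ≠ r := by
  rintro rfl
  rw [quartic_eval_initial] at hP
  refine h ?_
  have : ρ - (y₀ + 1) * (z₀ + ρ) = 0 := by
    simp only [pZero] at hρ
    linear_combination hρ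
  rw [hP, this]
  ring

end HeisMagnetic

theorem theorem3 (ρ x₀ y₀ z₀ : ℝ) :
    -- the equation determines the magnetic trajectories of `F_{e₁,ρ}` through the identity
    (∀ I : Set ℝ, IsOpenIntervalAtZero I → ∀ γ : ℝ → Fin 3 → ℝ,
      (IsMagneticTrajectoryOn (lorentzMatrix 1 0 ρ) I γ ∧ γ 0 = 0 ∧ deriv γ 0 = ![x₀, y₀, z₀]) ↔
      (IsSolutionOn ρ x₀ y₀ z₀ I (fun t => γ t 0) ∧
        ∀ t ∈ I,
          γ t 1 = ∫ s in (0 : ℝ)..t, ((γ s 0) ^ 2 / 2 + (z₀ + ρ) * γ s 0 + y₀) ∧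
          γ t 2 = -(1 / 2) * γ t 0 * γ t 1 - (z₀ + ρ) * γ t 1
            - deriv (fun s => γ s 0) t + x₀)) ∧
    -- the degenerate case
    (x₀ = 0 → (y₀ + 1) * (z₀ + ρ) = ρ → IsTheSolution ρ x₀ y₀ z₀ (fun _ => 0)) ∧
    -- the non-degenerate case
    (x₀ ^ 2 + (ρ - (y₀ + 1) * (z₀ + ρ)) ^ 2 ≠ 0 → 0 ≤ x₀ →
      ∀ c p₀ q₀ Δ : ℝ, c = z₀ + ρ → p₀ = pZero ρ y₀ z₀ → q₀ = qZero ρ x₀ y₀ z₀ →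
        Δ = discPoly ρ p₀ q₀ →
      -- two real and two non-real roots
      (Δ < 0 → ∃ r₁ r₄ : ℝ, ∃ r₂ : ℂ, r₁ < r₄ ∧ r₂.im ≠ 0 ∧
        ((quartic ρ x₀ y₀ z₀).map (algebraMap ℝ ℂ)).roots
          = {(r₁ : ℂ), (r₄ : ℂ), r₂, (starRingEnd ℂ) r₂} ∧
        ∀ d₁ d₄ k : ℝ, d₁ = ‖(r₁ : ℂ) - r₂‖ → d₄ = ‖(r₄ : ℂ) - r₂‖ →
          k = modulusCn r₁ r₄ d₁ d₄ →
          0 < k ∧ k < 1 ∧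
          IsTheSolution ρ x₀ y₀ z₀ (solCn c r₁ r₄ d₁ d₄) ∧
          HasPeriod (solCn c r₁ r₄ d₁ d₄) (8 * ellipticK k / √(d₁ * d₄)) ∧
          Set.range (solCn c r₁ r₄ d₁ d₄) = Set.Icc (r₁ - c) (r₄ - c)) ∧
      -- four real roots
      (0 < Δ → ∃ r₁ r₂ r₃ r₄ : ℝ, r₁ < r₂ ∧ r₂ < r₃ ∧ r₃ < r₄ ∧
        (quartic ρ x₀ y₀ z₀).roots = {r₁, r₂, r₃, r₄} ∧
        ((r₁ ≤ c ∧ c ≤ r₂) ∨ (r₃ ≤ c ∧ c ≤ r₄)) ∧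
        ∀ k₁ : ℝ, k₁ = modulusSn r₁ r₂ r₃ r₄ →
          0 < k₁ ∧ k₁ < 1 ∧
          (r₁ ≤ c → c ≤ r₂ →
            IsTheSolution ρ x₀ y₀ z₀ (solSnLow c r₁ r₂ r₃ r₄) ∧
            HasPeriod (solSnLow c r₁ r₂ r₃ r₄)
              (8 * ellipticK k₁ / √((r₄ - r₂) * (r₃ - r₁))) ∧
            Set.range (solSnLow c r₁ r₂ r₃ r₄) = Set.Icc (r₁ - c) (r₂ - c)) ∧
          (r₃ ≤ c → c ≤ r₄ →
            IsTheSolution ρ x₀ y₀ z₀ (solSnHigh c r₁ r₂ r₃ r₄) ∧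
            HasPeriod (solSnHigh c r₁ r₂ r₃ r₄)
              (8 * ellipticK k₁ / √((r₄ - r₂) * (r₃ - r₁))) ∧
            Set.range (solSnHigh c r₁ r₂ r₃ r₄) = Set.Icc (r₃ - c) (r₄ - c))) ∧
      -- a double root
      (Δ = 0 → p₀ ^ 2 + 3 * q₀ ≠ 0 →
        ∀ r μ : ℝ, r = rPar ρ p₀ q₀ → μ = muPar ρ p₀ q₀ →
          (quartic ρ x₀ y₀ z₀).rootMultiplicity r = 2 ∧ μ = (p₀ + 3 * r ^ 2) / 2 ∧
          μ ≠ 0 ∧ c ≠ r ∧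
          (0 < μ →
            IsTheSolution ρ x₀ y₀ z₀ (solCos c r μ) ∧
            HasPeriod (solCos c r μ) (2 * Real.pi / √μ) ∧
            Set.range (solCos c r μ)
              = Set.Icc (-r - √(-2 * (p₀ + r ^ 2)) - c) (-r + √(-2 * (p₀ + r ^ 2)) - c)) ∧
          (μ < 0 → r < c →
            IsTheSolution ρ x₀ y₀ z₀ (solCoshRight c r μ) ∧
            NotPeriodic (solCoshRight c r μ) ∧
            Set.range (solCoshRight c r μ)
              = Set.Ioc (r - c) (-r + √(-2 * (p₀ + r ^ 2)) - c)) ∧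
          (μ < 0 → c < r →
            IsTheSolution ρ x₀ y₀ z₀ (solCoshLeft c r μ) ∧
            NotPeriodic (solCoshLeft c r μ) ∧
            Set.range (solCoshLeft c r μ)
              = Set.Ico (-r - √(-2 * (p₀ + r ^ 2)) - c) (r - c))) ∧
      -- a triple root
      (Δ = 0 → p₀ ^ 2 + 3 * q₀ = 0 →
        ∀ r : ℝ, r = -cubeRoot ρ →
          (quartic ρ x₀ y₀ z₀).rootMultiplicity r = 3 ∧ ρ ≠ 0 ∧
          IsTheSolution ρ x₀ y₀ z₀ (solRational c r) ∧
          NotPeriodic (solRational c r) ∧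
          (0 < ρ → Set.range (solRational c r)
            = Set.Ioc (-cubeRoot ρ - c) (3 * cubeRoot ρ - c)) ∧
          (ρ < 0 → Set.range (solRational c r)
            = Set.Ico (3 * cubeRoot ρ - c) (-cubeRoot ρ - c)))) := by
  refine ⟨fun I hI γ => ⟨fun ⟨h, h0, h0'⟩ => h.isSolutionOn hI h0 h0',
    fun ⟨h, hyz⟩ => h.isMagneticTrajectoryOn hI hyz⟩, isTheSolution_zero, ?_⟩
  rintro hnd hx₀ c p₀ q₀ Δ rfl hp hq rfl
  refine ⟨fun hΔ => ?_, fun hΔ => ?_, fun hΔ hpq => ?_, fun hΔ hpq => ?_⟩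
  · rw [hp, hq] at hΔ
    obtain ⟨r₁, r₄, α, β, hr, hβ, hP⟩ := exists_roots_of_disc_neg hnd hΔ
    have hPr : ∀ η, (quartic ρ x₀ y₀ z₀).eval η
        = -((η - r₁) * (η - r₄) * ((η - α) ^ 2 + β ^ 2)) / 4 := fun η => by
      have h := hP η
      rw [Polynomial.eval_map_algebraMap, Complex.coe_algebraMap.symm,
        Polynomial.aeval_algebraMap_apply] at h
      simp only [Complex.coe_algebraMap, Polynomial.coe_aeval_eq_eval] at h
      exact_mod_cast h
    refine ⟨r₁, r₄, ⟨α, β⟩, hr, hβ, ?_, ?_⟩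
    · refine roots_of_eval_eq (l := -(1 / 4)) (by norm_num) fun z => ?_
      rw [hP]
      have e1 : (⟨α, β⟩ : ℂ) = α + β * Complex.I := Complex.mk_eq_add_mul_I α β
      have e2 : (starRingEnd ℂ) (⟨α, β⟩ : ℂ) = α - β * Complex.I := by
        rw [e1]
        simp [sub_eq_add_neg]
      rw [e2, e1]
      linear_combination -(z - r₁) * (z - r₄) * β ^ 2 / 4 * Complex.I_sq
    · intro d₁ d₄ k hd₁ hd₄ hk
      have hnorm : ∀ r : ℝ, ‖(r : ℂ) - ⟨α, β⟩‖ ^ 2 = (r - α) ^ 2 + β ^ 2 := fun r => by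
        rw [← Complex.normSq_eq_norm_sq, Complex.normSq_apply]
        simp
        ring
      have hpos : ∀ r : ℝ, 0 < ‖(r : ℂ) - ⟨α, β⟩‖ := fun r =>
        norm_pos_iff.2 fun h => hβ (by simpa using congrArg Complex.im h)
      exact solCn_spec hx₀ hβ hr (hd₁ ▸ hpos r₁) (hd₄ ▸ hpos r₄) (hd₁ ▸ hnorm r₁)
        (hd₄ ▸ hnorm r₄) hPr hk
  · rw [hp, hq] at hΔ
    obtain ⟨r₁, r₂, r₃, r₄, h₁₂, h₂₃, h₃₄, hP⟩ := exists_roots_of_disc_pos hnd hΔ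
    refine ⟨r₁, r₂, r₃, r₄, h₁₂, h₂₃, h₃₄, ?_, ?_, fun k hk => ?_⟩
    · refine roots_of_eval_eq (l := -(1 / 4)) (by norm_num) fun η => ?_
      rw [hP]
      ring
    · have h := quartic_eval_initial ρ x₀ y₀ z₀
      rw [hP] at h
      have hle : (z₀ + ρ - r₁) * (z₀ + ρ - r₂) * (z₀ + ρ - r₃) * (z₀ + ρ - r₄) ≤ 0 := by
        linarith [sq_nonneg x₀]
      generalize z₀ + ρ = c at hle
      -- outside the two intervals the product of the four differences is positive
      by_contra! hcon
      refine hle.not_gt ?_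
      rcases lt_or_ge c r₁ with h1 | h1
      · have e := mul_pos (mul_pos (sub_pos.2 h1) (sub_pos.2 (h1.trans h₁₂)))
          (mul_pos (sub_pos.2 (h1.trans (h₁₂.trans h₂₃)))
            (sub_pos.2 (h1.trans (h₁₂.trans (h₂₃.trans h₃₄)))))
        exact e.trans_eq (by ring)
      · have h2 := hcon.1 h1
        rcases lt_or_ge c r₃ with h3 | h3
        · have e := mul_pos (mul_pos (sub_pos.2 (h₁₂.trans h2)) (sub_pos.2 h2))
            (mul_pos (sub_pos.2 h3) (sub_pos.2 (h3.trans h₃₄)))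
          exact e.trans_eq (by ring)
        · have h4 := hcon.2 h3
          exact mul_pos (mul_pos (mul_pos (sub_pos.2 (h₁₂.trans h2)) (sub_pos.2 h2))
            (sub_pos.2 (h₃₄.trans h4))) (sub_pos.2 h4)
    · obtain ⟨-, hk0, hk1⟩ := modulusSn_sq h₁₂ h₂₃ h₃₄
      rw [← hk] at hk0 hk1
      exact ⟨hk0, hk1, solSnLow_spec hx₀ h₁₂ h₂₃ h₃₄ hP hk,
        solSnHigh_spec hx₀ h₁₂ h₂₃ h₃₄ hP hk⟩
  · rintro r μ hr hμ
    rw [hp, hq] at hΔ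
    obtain ⟨R, hρ, hqR, hneg⟩ := exists_double_root hnd hΔ
    rw [← hp] at hρ hneg
    rw [← hp, ← hq] at hqR
    have h₃ : p₀ + 3 * R ^ 2 ≠ 0 := by
      rw [sq_add_three_mul_of_double_root hqR] at hpq
      exact (pow_ne_zero_iff two_ne_zero).1 hpq
    rw [rPar_of_double_root hρ hqR hneg.ne h₃] at hr
    rw [muPar_of_double_root hρ hqR h₃] at hμ
    subst hr
    -- half the difference of the two simple roots, so that `√(-2 (p₀ + r²)) = 2 s`
    set s := √(-(p₀ + r ^ 2) / 2) with hs
    have hs0 : 0 < s := Real.sqrt_pos.2 (by linarith)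
    have hs2 : s ^ 2 = -(p₀ + r ^ 2) / 2 := Real.sq_sqrt (by linarith)
    have hd : √(-2 * (p₀ + r ^ 2)) = 2 * s := by
      rw [show -2 * (p₀ + r ^ 2) = (2 * s) ^ 2 by rw [mul_pow, hs2]; ring,
        Real.sqrt_sq (by positivity)]
    have hP : ∀ η, (quartic ρ x₀ y₀ z₀).eval η
        = -((η - r) ^ 2 * ((η + r) ^ 2 - 4 * s ^ 2)) / 4 := fun η => by
      rw [quartic_eval, ← hp, ← hq, hs2, hqR]
      linear_combination 2 * η * hρ
    have hμs : μ = r ^ 2 - s ^ 2 := by rw [hμ, hs2]; ring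
    have hμ0 : μ ≠ 0 := by rw [hμ]; exact div_ne_zero h₃ two_ne_zero
    have hc : z₀ + ρ ≠ r := initial_ne_of_double_root hnd (hp ▸ hρ) (by rw [hP]; ring)
    rw [hd]
    refine ⟨?_, hμ, hμ0, hc, fun h => solCos_spec hx₀ hs0 hμs h hP hc,
      fun h hcr => solCoshRight_spec hx₀ hs0 hμs h hP hcr,
      fun h hcr => solCoshLeft_spec hx₀ hs0 hμs h hP hcr⟩
    refine rootMultiplicity_of_eval_eq
      (G := Polynomial.C (-(1 / 4))
        * ((Polynomial.X + Polynomial.C r) ^ 2 - Polynomial.C (4 * s ^ 2))) ?_ fun η => ?_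
    · have : (Polynomial.C (-(1 / 4))
          * ((Polynomial.X + Polynomial.C r) ^ 2 - Polynomial.C (4 * s ^ 2))).eval r = -μ := by
        simp [hμs]
        ring
      rw [this]
      exact neg_ne_zero.2 hμ0
    · rw [hP]
      simp
      ring
  · rintro r hr
    rw [hp, hq] at hΔ
    obtain ⟨R, hρ, hqR, hneg⟩ := exists_double_root hnd hΔ
    rw [← hp] at hρ hneg
    rw [← hp, ← hq] at hqR
    have h₃ : p₀ = -(3 * R ^ 2) := by
      rw [sq_add_three_mul_of_double_root hqR] at hpq
      linarith [(pow_eq_zero_iff two_ne_zero).1 hpq]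
    have hρR : ρ = -R ^ 3 := by rw [h₃] at hρ; linarith
    have hcube : cubeRoot ρ = -R := by rw [hρR, cubeRoot_neg_pow_three]
    rw [hcube, neg_neg] at hr
    subst hr
    have hr0 : r ≠ 0 := by
      rintro rfl
      rw [h₃] at hneg
      norm_num at hneg
    have hP : ∀ η, (quartic ρ x₀ y₀ z₀).eval η = -((η - r) ^ 3 * (η + 3 * r)) / 4 := fun η => by
      rw [quartic_eval, ← hp, ← hq, hqR, h₃]
      linear_combination 2 * η * hρR
    have hc : z₀ + ρ ≠ r := initial_ne_of_double_root hnd (hp ▸ hρ) (by rw [hP]; ring)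
    obtain ⟨hsol, hnp, hrg, hrg'⟩ := solRational_spec hx₀ hr0 hP hc
    refine ⟨?_, ?_, hsol, hnp, fun h => ?_, fun h => ?_⟩
    · refine rootMultiplicity_of_eval_eq
        (G := Polynomial.C (-(1 / 4)) * (Polynomial.X + Polynomial.C (3 * r))) ?_ fun η => ?_
      · have : (Polynomial.C (-(1 / 4))
            * (Polynomial.X + Polynomial.C (3 * r))).eval r = -r := by
          simp
          ring
        rw [this]
        exact neg_ne_zero.2 hr0
      · rw [hP]
        simp
        ring
    · rw [hρR]
      exact neg_ne_zero.2 (pow_ne_zero 3 hr0)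
    · have hr' : r < 0 := by
        by_contra! hge
        have := pow_nonneg hge 3
        linarith
      rw [hrg hr', hcube]
      congr 2 <;> ring
    · have hr' : 0 < r := by
        by_contra! hle
        have := Odd.pow_nonpos (by decide : Odd 3) hle
        linarith
      rw [hrg' hr', hcube]
      congr 2 <;> ring
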